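/- Let $P,Q\in\mathbb{C}[x,y]$ be polynomials whose Jacobian $P_xQ_y-P_yQ_x$ is a nonzero constant, and let $f=(P,Q):\mathbb{C}^2\to\mathbb{C}^2$. Suppose that $\deg P=Kd$ and $\deg Q=Ke$ (total degrees) with natural numbers $K,d,e$, $\gcd(d,e)=1$, and that $P$ and $Q$ are monic in $y$ up to nonzero constants $A,B\in\mathbb{C}$, that is, $$P(x,y)=Ay^{Kd}+\dots+a_1(x)y+a_0(x),\qquad Q(x,y)=By^{Ke}+\dots+b_1(x)y+b_0(x),\qquad A\ne0,\ B\neq 0,$$ with $a_i,b_j\in\mathbb{C}[x]$. Let $A_f$ be the non-proper value set of $f$, i.e. the set of all $a\in\mathbb{C}^2$ such that $f^{-1}(N)$ is not compact for every compact neighbourhood $N$ of $a$. If $A_f\neq\emptyset$, then for every irreducible component $\ell$ of $A_f$ (with respect to the Zariski topology of $\mathbb{C}^2$) there are an integer $m\ge1$ and polynomials $p,q\in\mathbb{C}[\xi]$ of the form $$p(\xi)=A\xi^{md}+\text{lower terms in }\xi,\qquad q(\xi)=B\xi^{me}+\text{lower terms in }\xi,$$ such that $\ell=\{(p(\xi),q(\xi)):\xi\in\mathbb{C}\}$.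 -/

import Mathlib

open scoped Topology

noncomputable section

namespace PlanePoly

/-- The affine plane `ℂ²`; coordinate `0` is `x` (resp. `u`), coordinate `1` is `y` (resp. `v`). -/
abbrev Plane : Type := Fin 2 → ℂ

/-- Polynomials in `x = X 0` and `y = X 1`. -/
abbrev Poly : Type := MvPolynomial (Fin 2) ℂ

/-- The polynomial map `(P, Q) : ℂ² → ℂ²`. -/
def polyMap (P Q : Poly) : Plane → Plane :=
  fun z => ![MvPolynomial.eval z P, MvPolynomial.eval z Q]

/-- The Jacobian determinant `P_x Q_y - P_y Q_x`. -/
def jacobian (P Q : Poly) : Poly :=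
  MvPolynomial.pderiv 0 P * MvPolynomial.pderiv 1 Q -
    MvPolynomial.pderiv 1 P * MvPolynomial.pderiv 0 Q

/-- `P(x, y) = c y ^ n + a_{n-1}(x) y ^ (n-1) + ... + a_1(x) y + a_0(x)` with a nonzero
constant `c`. -/
def IsMonicInY (P : Poly) (n : ℕ) (c : ℂ) : Prop :=
  c ≠ 0 ∧ ∃ a : Fin n → Polynomial ℂ,
    P = MvPolynomial.C c * MvPolynomial.X 1 ^ n +
      ∑ i : Fin n, Polynomial.aeval (MvPolynomial.X 0 : Poly) (a i) *
        MvPolynomial.X 1 ^ (i : ℕ)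

/-- The non-proper value set of `f`: the points `a` such that `f ⁻¹(K)` is not compact for
every compact neighbourhood `K` of `a` (Euclidean topology). -/
def nonProperValueSet (f : Plane → Plane) : Set Plane :=
  {a | ∀ K ∈ 𝓝 a, IsCompact K → ¬ IsCompact (f ⁻¹' K)}

/-- The Zariski topology on `ℂ²`, generated by the complements of the zero sets of
polynomials. It is not an instance: `Plane` carries its Euclidean topology by default. -/
abbrev zariski : TopologicalSpace Plane :=
  TopologicalSpace.generateFrom
    {U | ∃ g : Poly, U = {z | MvPolynomial.eval z g ≠ 0}}

/-- `Z` is an irreducible component of `S ⊆ ℂ²`: a maximal Zariski-irreducible subset of `S`. -/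
def IsIrreducibleComponent (Z S : Set Plane) : Prop :=
  Maximal (fun T : Set Plane => T ⊆ S ∧ @IsIrreducible Plane zariski T) Z

end PlanePoly

end

/-! A non-proper value is a limit of `f` along points escaping to infinity. Since `P` is monic in
`y` and stays bounded there, `x → ∞` while `y / x` is bounded. So put `x = t ^ (-m)`, `y = t ^ (-m)
* Y` with `t → 0`. With `n = dK`, `n' = eK` this turns `P`, `Q` into `t ^ (-mn) * G`, `t ^ (-mn') *
H`, where `G`, `H` are polynomials in `t`, `Y` with constant leading coefficients `A`, `B` in `Y`.
By Newton–Puiseux (`Puiseux.splitsAfterExpand`), for suitable `m` both are constants times products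
of factors `Y - u(t)` modulo a high power of `t`.

Take one of these roots as center `w` and zoom in by `Y = w + t ^ k * ξ`, `k = 0, 1, 2, ...`. Let
`p_k(ξ)`, `q_k(ξ)` be the lowest coefficients in `t` of the two products, of orders `α_k`, `β_k`.
The trailing monomial of `p_k` is the leading monomial of `p_{k+1}` (`residueFactor_succ`). As long
as both orders are below their targets, constancy of the Jacobian yields `(mn - α_k) p_k q_k' - (mn'
- β_k) q_k p_k' = const` (`exists_wronskian_eq_C`). If the orders eventually reach the targets `mn`,
`mn'`, then before that `p_k` and `q_k` vanish at `0`, so the constant is `0` and `p_k ^ e`, `q_k ^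
d` are proportional. Hence degrees, orders and leading coefficients stay matched in the ratio `d :
e` (`exists_dicritical`). Extra ramification prevents `α_k` from jumping over `mn`
(`totalOrder_hits`). Once `α_k = mn`, also `β_k = mn'`, the powers of `t` cancel, and `f` tends to
`(p_k(ξ), q_k(ξ))`.

Conversely, along an escaping ultrafilter take the nearest root as center: both orders reach their
targets and `ξ` stays bounded, so the limit lies on one of finitely many such curves
(`exists_finite_cover`). These curves are Zariski closed and irreducible, so every component is one
of them, and a rescaling of `ξ` normalizes the leading coefficients (`exists_rescale`). -/

/-! ### The Newton–Puiseux theorem, exact and truncated. -/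

namespace Puiseux

open Polynomial

variable {k : Type*} [Field k]

/-- After a substitution `t ↦ t ^ s`, the polynomial `F` over `k⟦t⟧` is a product of monic linear
factors. -/
def SplitsAfterExpand (F : (PowerSeries k)[X]) : Prop :=
  ∃ (s : ℕ) (hs : s ≠ 0) (us : Multiset (PowerSeries k)),
    F.map (PowerSeries.expand s hs : PowerSeries k →ₐ[k] PowerSeries k).toRingHom =
      (us.map fun u => X - C u).prod

theorem map_expand_mul (F : (PowerSeries k)[X]) (r s : ℕ) (hr : r ≠ 0) (hs : s ≠ 0) :
    F.map (PowerSeries.expand (r * s) (mul_ne_zero hr hs) : _ →ₐ[k] _).toRingHom =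
      (F.map (PowerSeries.expand s hs : _ →ₐ[k] _).toRingHom).map
        (PowerSeries.expand r hr : _ →ₐ[k] _).toRingHom := by
  ext1 i
  rw [coeff_map, coeff_map, coeff_map]
  exact PowerSeries.expand_mul r hr s hs _

theorem map_prod_X_sub_C {R S : Type*} [CommRing R] [CommRing S] (f : R →+* S)
    (us : Multiset R) :
    ((us.map fun u => X - C u).prod).map f = ((us.map f).map fun u => X - C u).prod := by
  induction us using Multiset.induction with
  | empty => simp
  | cons a s ih => simp [Polynomial.map_mul, ih]

theorem SplitsAfterExpand.of_expand {F : (PowerSeries k)[X]} {s : ℕ} {hs : s ≠ 0}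
    (h : SplitsAfterExpand (F.map (PowerSeries.expand s hs : _ →ₐ[k] _).toRingHom)) :
    SplitsAfterExpand F := by
  obtain ⟨r, hr, us, hus⟩ := h
  exact ⟨r * s, mul_ne_zero hr hs, us, by rw [map_expand_mul F r s hr hs, hus]⟩

theorem SplitsAfterExpand.mul {F G : (PowerSeries k)[X]} (hF : SplitsAfterExpand F)
    (hG : SplitsAfterExpand G) : SplitsAfterExpand (F * G) := by
  obtain ⟨r, hr, us, hus⟩ := hF
  obtain ⟨s, hs, vs, hvs⟩ := hG
  refine ⟨s * r, mul_ne_zero hs hr,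
    us.map (PowerSeries.expand s hs : _ →ₐ[k] _).toRingHom +
      vs.map (PowerSeries.expand r hr : _ →ₐ[k] _).toRingHom, ?_⟩
  rw [Multiset.map_add, Multiset.prod_add, ← map_prod_X_sub_C, ← map_prod_X_sub_C,
    Polynomial.map_mul, ← hus, ← hvs, ← map_expand_mul, ← map_expand_mul]
  simp only [mul_comm s r]

theorem prod_X_sub_C_comp {R : Type*} [CommRing R] (us : Multiset R) (a : R) :
    ((us.map fun u => X - C u).prod).comp (X - C a) =
      ((us.map (· + a)).map fun u => X - C u).prod := by
  induction us using Multiset.induction with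
  | empty => simp
  | cons b s ih => simp only [Multiset.map_cons, Multiset.prod_cons, mul_comp, ih]; simp; ring

theorem SplitsAfterExpand.of_comp_X_add_C {F : (PowerSeries k)[X]} {a : PowerSeries k}
    (h : SplitsAfterExpand (F.comp (X + C a))) : SplitsAfterExpand F := by
  obtain ⟨s, hs, us, hus⟩ := h
  refine ⟨s, hs, us.map (· + PowerSeries.expand s hs a), ?_⟩
  rw [← prod_X_sub_C_comp, ← hus, Polynomial.map_comp, comp_assoc]
  simp

theorem SplitsAfterExpand.scaleRoots {F : (PowerSeries k)[X]} (hF : F.Monic)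
    (h : SplitsAfterExpand F) (a : PowerSeries k) : SplitsAfterExpand (F.scaleRoots a) := by
  obtain ⟨s, hs, us, hus⟩ := h
  refine ⟨s, hs, us.map (PowerSeries.expand s hs a * ·), ?_⟩
  rw [map_scaleRoots _ _ _ (by simp [hF.leadingCoeff]), hus]
  simp only [AlgHom.toRingHom_eq_coe, RingHom.coe_coe]
  generalize PowerSeries.expand s hs a = b
  clear hus
  induction us using Multiset.induction with
  | empty => simp
  | cons c s ih =>
    simp only [Multiset.map_cons, Multiset.prod_cons, mul_scaleRoots_of_noZeroDivisors, ih]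
    congr 1
    ext i
    rw [coeff_scaleRoots, natDegree_X_sub_C]
    rcases i with _ | _ | i
    · simp [mul_comm]
    · simp
    · simp [coeff_X]

/-- A monic polynomial over `k⟦t⟧` whose reduction is divisible by `X` but is not a power of `X`
is a product of two monic polynomials of smaller degree. -/
theorem exists_mul_of_residue {F : (PowerSeries k)[X]} (hF : F.Monic)
    (h0 : PowerSeries.constantCoeff (F.coeff 0) = 0)
    (h1 : ∃ i < F.natDegree, PowerSeries.constantCoeff (F.coeff i) ≠ 0) :
    ∃ D E : (PowerSeries k)[X], D.Monic ∧ E.Monic ∧ D.natDegree < F.natDegree ∧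
      E.natDegree < F.natDegree ∧ F = D * E := by
  have hres : ∀ a : PowerSeries k, IsLocalRing.residue (PowerSeries k) a = 0 ↔
      PowerSeries.constantCoeff a = 0 := by
    intro a
    rw [IsLocalRing.residue_eq_zero_iff, PowerSeries.maximalIdeal_eq_span_X,
      Ideal.mem_span_singleton, PowerSeries.X_dvd_iff]
  have : IsAdicComplete (IsLocalRing.maximalIdeal (PowerSeries k)) (PowerSeries k) := by
    rw [PowerSeries.maximalIdeal_eq_span_X]; infer_instance
  obtain ⟨i, hi, hi0⟩ := h1
  have hci : PowerSeries.coeff i (PowerSeries.map (IsLocalRing.residue (PowerSeries k))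
      (F : PowerSeries (PowerSeries k))) ≠ 0 := by
    rw [PowerSeries.coeff_map, Polynomial.coeff_coe]
    exact fun h => hi0 ((hres _).1 h)
  have hne : PowerSeries.map (IsLocalRing.residue (PowerSeries k))
      (F : PowerSeries (PowerSeries k)) ≠ 0 := fun h => hci (by rw [h]; simp)
  -- Weierstrass preparation for `F` as a power series in `X` over the complete local ring `k⟦t⟧`.
  -- The degree of `D` is the order of the reduction, which is positive by `h0` and less than
  -- `F.natDegree` by `h1`.
  obtain ⟨D, h, H⟩ := PowerSeries.exists_isWeierstrassFactorization hne
  have hDm : D.Monic := H.isDistinguishedAt.monic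
  have hdeg := H.natDegree_eq_toNat_order_map
  have hDlt : D.natDegree < F.natDegree := by
    refine lt_of_le_of_lt ?_ hi
    rw [hdeg]
    have := PowerSeries.order_le i hci
    exact ENat.toNat_le_of_le_natCast this
  have hDpos : 0 < D.natDegree := by
    rw [Nat.pos_iff_ne_zero, hdeg]
    intro h
    have h2 := PowerSeries.coeff_order hne
    rw [h, PowerSeries.coeff_map, Polynomial.coeff_coe] at h2
    exact h2 ((hres _).2 h0)
  -- Uniqueness of Weierstrass division: `F = D * h` is already a division with remainder zero, so
  -- the polynomial division has the same remainder.
  have hdiv : F %ₘ D = 0 := by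
    have hWD := H.isDistinguishedAt.isWeierstrassDivisorAt'
    have hord : ENat.toNat (D.natDegree : ℕ∞) = _ := congrArg ENat.toNat
      (H.isDistinguishedAt.coe_natDegree_eq_order_map D 1
        (by rw [PowerSeries.constantCoeff_one, ← Ideal.ne_top_iff_one]
            exact Ideal.IsPrime.ne_top') (by simp))
    rw [ENat.toNat_natCast] at hord
    have hlt : (F %ₘ D).degree < ((PowerSeries.map (Ideal.Quotient.mk
        (IsLocalRing.maximalIdeal (PowerSeries k))) (D : PowerSeries _)).order.toNat : ℕ) := by
      rw [← hord, ← degree_eq_natDegree hDm.ne_zero]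
      exact degree_modByMonic_lt _ hDm
    refine (hWD.eq_of_mul_add_eq_mul_add (q := ((F /ₘ D : (PowerSeries k)[X]) :
      PowerSeries (PowerSeries k))) (q' := h) (r' := 0) hlt (by simp) ?_).2
    rw [Polynomial.coe_zero, add_zero, ← H.eq_mul, ← Polynomial.coe_mul, ← Polynomial.coe_add,
      add_comm, modByMonic_add_div]
  have hmul : F = D * (F /ₘ D) := by
    conv_lhs => rw [← modByMonic_add_div F D, hdiv, zero_add]
  have hE : (F /ₘ D).Monic := hDm.of_mul_monic_left (hmul ▸ hF)
  refine ⟨D, F /ₘ D, hDm, hE, hDlt, ?_, hmul⟩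
  have := congrArg natDegree hmul
  rw [hDm.natDegree_mul hE] at this
  omega

/-- A monic polynomial of degree `n` with vanishing coefficient in degree `n - 1` which is not
`X ^ n` becomes, after a substitution `t ↦ t ^ s`, of the form `E.scaleRoots (t ^ r)`, where the
reduction of `E` is not `X ^ n`. -/
theorem exists_scaleRoots {F : (PowerSeries k)[X]} (hF : F.Monic)
    (h1 : F.coeff (F.natDegree - 1) = 0) (h : ∃ i < F.natDegree, F.coeff i ≠ 0) :
    ∃ (s : ℕ) (hs : s ≠ 0) (r : ℕ) (E : (PowerSeries k)[X]), E.Monic ∧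
      E.natDegree = F.natDegree ∧ E.coeff (F.natDegree - 1) = 0 ∧
      (∃ i < F.natDegree, PowerSeries.constantCoeff (E.coeff i) ≠ 0) ∧
      F.map (PowerSeries.expand s hs : _ →ₐ[k] _).toRingHom =
        E.scaleRoots (PowerSeries.X ^ r) := by
  classical
  set n := F.natDegree with hn
  have hs : n.factorial ≠ 0 := n.factorial_ne_zero
  -- The Newton polygon slope `ord(a_i) / (n - i)`, cleared of denominators by `n!`; its minimum is
  -- the common order to be divided out of the roots. Zero coefficients are filtered out below, as
  -- `toNat` sends their order `⊤` to `0`.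
  let ρ : ℕ → ℕ := fun i => (F.coeff i).order.toNat * (n.factorial / (n - i))
  have hρ : ∀ i < n, ρ i * (n - i) = n.factorial * (F.coeff i).order.toNat := by
    intro i hi
    have : (n - i) ∣ n.factorial := Nat.dvd_factorial (by omega) (by omega)
    simp only [ρ]
    rw [mul_assoc, Nat.div_mul_cancel this, mul_comm]
  obtain ⟨i₀, hi₀, hmin⟩ := Finset.exists_min_image
    ((Finset.range n).filter fun i => F.coeff i ≠ 0) ρ (by
      obtain ⟨i, hi, hi'⟩ := h
      exact ⟨i, by simp [hi, hi']⟩)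
  simp only [Finset.mem_filter, Finset.mem_range] at hi₀ hmin
  have hordexp : ∀ i, F.coeff i ≠ 0 →
      ((PowerSeries.expand n.factorial hs : _ →ₐ[k] _) (F.coeff i)).order.toNat =
        n.factorial * (F.coeff i).order.toNat := by
    intro i hi
    rw [PowerSeries.order_expand]
    simp
  have hdvd : ∀ i < n, PowerSeries.X ^ (ρ i₀ * (n - i)) ∣
      (PowerSeries.expand n.factorial hs : _ →ₐ[k] _) (F.coeff i) := by
    intro i hi
    by_cases h0 : F.coeff i = 0
    · simp [h0]
    refine (pow_dvd_pow _ ?_).trans PowerSeries.X_pow_order_dvd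
    rw [hordexp i h0, ← hρ i hi]
    exact Nat.mul_le_mul_right _ (hmin i ⟨hi, h0⟩)
  choose! b hb using hdvd
  have hbn : b (n - 1) = 0 ∨ n = 0 := by
    rcases Nat.eq_zero_or_pos n with h0 | h0
    · exact Or.inr h0
    left
    have := hb (n - 1) (by omega)
    rw [h1, map_zero] at this
    exact (mul_eq_zero.1 this.symm).resolve_left (pow_ne_zero _ PowerSeries.X_ne_zero)
  let q : (PowerSeries k)[X] := ∑ i ∈ Finset.range n, C (b i) * X ^ i
  have hqdeg : q.degree < n := by
    refine (degree_sum_le _ _).trans_lt ?_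
    rw [Finset.sup_lt_iff (by exact WithBot.bot_lt_coe n)]
    intro i hi
    exact (degree_C_mul_X_pow_le _ _).trans_lt (by exact_mod_cast Finset.mem_range.1 hi)
  have hqc : ∀ i < n, q.coeff i = b i := by
    intro i hi
    simp [q, coeff_C_mul, coeff_X_pow, hi]
  have hEm : (X ^ n + q).Monic := monic_X_pow_add hqdeg
  have hEd : (X ^ n + q).natDegree = n := by
    rw [natDegree_add_eq_left_of_degree_lt (by simpa using hqdeg), natDegree_X_pow]
  have hEc : ∀ i < n, (X ^ n + q).coeff i = b i := by
    intro i hi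
    rw [coeff_add, hqc i hi, coeff_X_pow, if_neg hi.ne, zero_add]
  have hn0 : n ≠ 0 := by omega
  refine ⟨n.factorial, hs, ρ i₀, X ^ n + q, hEm, hEd, ?_, ⟨i₀, hi₀.1, ?_⟩, ?_⟩
  · rw [hEc _ (by omega)]
    exact hbn.resolve_right hn0
  · rw [hEc _ hi₀.1]
    intro h0
    obtain ⟨c, hc⟩ := PowerSeries.X_dvd_iff.2 h0
    have h2 := hb i₀ hi₀.1
    have hne : (PowerSeries.expand n.factorial hs : _ →ₐ[k] _) (F.coeff i₀) ≠ 0 := by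
      intro h3
      have := PowerSeries.order_expand n.factorial hs (F.coeff i₀)
      rw [h3, PowerSeries.order_zero] at this
      have h4 : (F.coeff i₀).order ≠ ⊤ := by simpa using hi₀.2
      obtain ⟨a, ha⟩ := ENat.ne_top_iff_exists.1 h4
      rw [← ha] at this
      rw [nsmul_eq_mul] at this
      exact ENat.natCast_ne_top (n.factorial * a) (by push_cast; exact this.symm)
    -- At the minimizing index the divided power of `t` is the full order of the coefficient, so one
    -- more factor `t` is impossible.
    have h5 : PowerSeries.X ^ (ρ i₀ * (n - i₀) + 1) ∣
        (PowerSeries.expand n.factorial hs : _ →ₐ[k] _) (F.coeff i₀) :=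
      ⟨c, by rw [h2, hc]; ring⟩
    rw [hρ i₀ hi₀.1, ← hordexp i₀ hi₀.2] at h5
    exact PowerSeries.coeff_order hne (PowerSeries.X_pow_dvd_iff.1 h5 _ (Nat.lt_succ_self _))
  · ext1 i
    rw [coeff_map, coeff_scaleRoots, hEd]
    rcases lt_trichotomy i n with hi | hi | hi
    · rw [hEc i hi, ← pow_mul, mul_comm]
      exact hb i hi
    · subst hi
      have e1 := hF.coeff_natDegree
      have e2 := hEm.coeff_natDegree
      rw [hEd] at e2
      rw [← hn] at e1
      rw [e1, e2]
      simp
    · rw [coeff_eq_zero_of_natDegree_lt (hn ▸ hi), coeff_eq_zero_of_natDegree_lt (lt_of_eq_of_lt hEd hi)]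
      simp

/-- Move a root `c` of the reduction to `0`. If the shifted reduction were a pure power, the
original one would be `(X - c) ^ n`. Its vanishing subleading coefficient `-n * c` then forces `c =
0` in characteristic zero, against `h2`. Hence the polynomial factors and induction applies. -/
theorem splitsAfterExpand_of_residue_ne {F : (PowerSeries k)[X]} [IsAlgClosed k] [CharZero k]
    (hF : F.Monic)
    (h1 : F.coeff (F.natDegree - 1) = 0)
    (h2 : ∃ i < F.natDegree, PowerSeries.constantCoeff (F.coeff i) ≠ 0)
    (ih : ∀ E : (PowerSeries k)[X], E.Monic → E.natDegree < F.natDegree → SplitsAfterExpand E) :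
    SplitsAfterExpand F := by
  obtain ⟨i, hi, hi0⟩ := h2
  set f : k[X] := F.map PowerSeries.constantCoeff with hf
  have hfm : f.Monic := hF.map _
  have hfd : f.natDegree = F.natDegree := hF.natDegree_map _
  obtain ⟨c, hc⟩ := IsAlgClosed.exists_root f (by
    rw [degree_eq_natDegree hfm.ne_zero, hfd]
    exact_mod_cast (by omega : F.natDegree ≠ 0))
  apply SplitsAfterExpand.of_comp_X_add_C (a := PowerSeries.C c)
  have hGm : (F.comp (X + C (PowerSeries.C c))).Monic := hF.comp_X_add_C _
  have hGd : (F.comp (X + C (PowerSeries.C c))).natDegree = F.natDegree := by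
    rw [natDegree_comp, natDegree_X_add_C, mul_one]
  have hGf : (F.comp (X + C (PowerSeries.C c))).map PowerSeries.constantCoeff =
      f.comp (X + C c) := by
    simp [Polynomial.map_comp, hf]
  obtain ⟨D, E, hD, hE, hDd, hEd, hDE⟩ := exists_mul_of_residue hGm (by
    rw [← coeff_map, hGf, coeff_zero_eq_eval_zero, eval_comp]
    simpa using hc) (by
    by_contra hcon
    push Not at hcon
    rw [hGd] at hcon
    have hXn : f.comp (X + C c) = X ^ F.natDegree := by
      ext j
      rw [← hGf, coeff_map, coeff_X_pow]
      rcases lt_trichotomy j F.natDegree with hj | hj | hj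
      · rw [hcon j hj, if_neg hj.ne]
      · have := hGm.coeff_natDegree
        rw [hGd] at this
        simp [this, hj]
      · rw [coeff_eq_zero_of_natDegree_lt (hGd ▸ hj), if_neg hj.ne', map_zero]
    have hfX : f = (X - C c) ^ F.natDegree := by
      have := congrArg (fun p => p.comp (X - C c)) hXn
      simpa [comp_assoc] using this
    have hc0 : c = 0 := by
      have e1 : f.coeff (F.natDegree - 1) = 0 := by rw [hf, coeff_map, h1, map_zero]
      have e2 : f.nextCoeff = -(F.natDegree * c) := by
        rw [hfX, (monic_X_sub_C c).nextCoeff_pow, nextCoeff_X_sub_C]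
        simp
      rw [nextCoeff_of_natDegree_pos (by omega), hfd, e1] at e2
      have hn0 : (F.natDegree : k) ≠ 0 := by exact_mod_cast (by omega : F.natDegree ≠ 0)
      have := neg_eq_zero.1 e2.symm
      exact (mul_eq_zero.1 this).resolve_left hn0
    apply hi0
    rw [← coeff_map, ← hf, hfX, hc0, C_0, sub_zero, coeff_X_pow, if_neg hi.ne])
  rw [hGd] at hDd hEd
  rw [hDE]
  exact (ih D hD hDd).mul (ih E hE hEd)

/-- **Newton–Puiseux theorem**: over an algebraically closed field of characteristic zero, every
monic polynomial over `k⟦t⟧` splits after a substitution `t ↦ t ^ s`. -/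
theorem splitsAfterExpand [IsAlgClosed k] [CharZero k] (F : (PowerSeries k)[X]) (hF : F.Monic) :
    SplitsAfterExpand F := by
  induction hn : F.natDegree using Nat.strong_induction_on generalizing F with
  | _ n ih =>
  rcases Nat.eq_zero_or_pos n with h0 | hpos
  · subst h0
    refine ⟨1, one_ne_zero, 0, ?_⟩
    rw [hF.natDegree_eq_zero.1 hn]
    simp
  have hinv : IsUnit (n : PowerSeries k) := by
    have : (n : PowerSeries k) = PowerSeries.C (n : k) := by simp
    rw [this]
    exact (isUnit_iff_ne_zero.2 (by exact_mod_cast hpos.ne')).map _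
  obtain ⟨ν, hν⟩ := hinv.exists_left_inv
  -- Tschirnhaus shift by `-a_{n-1} / n`, which kills the subleading coefficient.
  apply SplitsAfterExpand.of_comp_X_add_C (a := -(ν * F.coeff (n - 1)))
  set G := F.comp (X + C (-(ν * F.coeff (n - 1)))) with hG
  have hGm : G.Monic := hF.comp_X_add_C _
  have hGd : G.natDegree = n := by rw [hG, natDegree_comp, natDegree_X_add_C, mul_one, hn]
  have hG1 : G.coeff (n - 1) = 0 := by
    have hle : (hasseDeriv (n - 1) F).natDegree ≤ 1 :=
      (natDegree_hasseDeriv_le _ _).trans (by omega)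
    rw [hG, ← taylor_apply, taylor_coeff, eq_X_add_C_of_natDegree_le_one hle, hasseDeriv_coeff,
      hasseDeriv_coeff, show 1 + (n - 1) = n by omega, zero_add, ← hn, hF.coeff_natDegree,
      Nat.choose_symm (by omega : 1 ≤ F.natDegree)]
    simp only [Nat.choose_one_right, Nat.choose_self, eval_add, eval_mul, eval_C, eval_X, hn]
    linear_combination (-F.coeff (n - 1)) * hν
  by_cases h : ∃ i < n, G.coeff i ≠ 0
  · obtain ⟨s, hs, r, E, hEm, hEd, hE1, hE2, hmap⟩ := exists_scaleRoots hGm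
      (by rw [hGd]; exact hG1) (by rw [hGd]; exact h)
    rw [hGd] at hEd hE1 hE2
    apply SplitsAfterExpand.of_expand (s := s) (hs := hs)
    rw [hmap]
    refine SplitsAfterExpand.scaleRoots hEm ?_ _
    refine splitsAfterExpand_of_residue_ne hEm (by rw [hEd]; exact hE1) (by rw [hEd]; exact hE2) ?_
    intro E' hE' hlt
    exact ih _ (hEd ▸ hlt) E' hE' rfl
  · push Not at h
    have hGX : G = X ^ n := by
      ext1 j
      rw [coeff_X_pow]
      rcases lt_trichotomy j n with hj | hj | hj
      · rw [h j hj, if_neg hj.ne]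
      · have := hGm.coeff_natDegree
        rw [hGd] at this
        simp [this, hj]
      · rw [coeff_eq_zero_of_natDegree_lt (hGd ▸ hj), if_neg hj.ne']
    exact ⟨1, one_ne_zero, Multiset.replicate n 0, by rw [hGX]; simp⟩

theorem coe_expand (s : ℕ) (hs : s ≠ 0) (p : k[X]) :
    ((expand k s p : k[X]) : PowerSeries k) =
      (PowerSeries.expand s hs : _ →ₐ[k] _) (p : PowerSeries k) := by
  ext i
  rw [Polynomial.coeff_coe, coeff_expand (Nat.pos_of_ne_zero hs), PowerSeries.coeff_expand]
  simp

theorem X_pow_dvd_of_coe {p : k[X]} {N : ℕ}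
    (h : (PowerSeries.X : PowerSeries k) ^ N ∣ (p : PowerSeries k)) : X ^ N ∣ p := by
  rw [PowerSeries.X_pow_dvd_iff] at h
  rw [Polynomial.X_pow_dvd_iff]
  intro d hd
  simpa using h d hd

theorem X_pow_dvd_sub_trunc (u : PowerSeries k) (N : ℕ) :
    (PowerSeries.X : PowerSeries k) ^ N ∣ u - (PowerSeries.trunc N u : PowerSeries k) := by
  rw [PowerSeries.X_pow_dvd_iff]
  intro m hm
  rw [map_sub, Polynomial.coeff_coe, PowerSeries.coeff_trunc, if_pos hm, sub_self]

/-- Approximate form of the Newton–Puiseux theorem: a monic polynomial over `k[t]` is, after a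
substitution `t ↦ t ^ s`, congruent to a product of linear factors modulo any power of `t`. -/
theorem exists_prod_add [IsAlgClosed k] [CharZero k] (F : k[X][X]) (hF : F.Monic) :
    ∃ s : ℕ, s ≠ 0 ∧ ∀ N : ℕ, ∃ (u : Fin F.natDegree → k[X]) (E : k[X][X]),
      F.map (expand k s).toRingHom = ∏ i, (X - C (u i)) + C (X ^ N) * E := by
  obtain ⟨s, hs, us, hus⟩ := splitsAfterExpand (F.map (coeToPowerSeries.ringHom (R := k)))
    (hF.map _)
  refine ⟨s, hs, fun N => ?_⟩
  obtain ⟨l, rfl⟩ := Quot.exists_rep us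
  have hlen : F.natDegree = l.length := by
    have h1 := congrArg natDegree hus
    rw [(hF.map _ |>.natDegree_map _), hF.natDegree_map] at h1
    rw [h1]
    simpa using natDegree_multiset_prod_X_sub_C_eq_card (l : Multiset (PowerSeries k))
  rw [hlen]
  refine ⟨fun i => PowerSeries.trunc N l[i], ?_⟩
  suffices h : C (X ^ N) ∣ F.map (expand k s).toRingHom -
      ∏ i : Fin l.length, (X - C (PowerSeries.trunc N l[i])) by
    obtain ⟨E, hE⟩ := h
    exact ⟨E, by rw [← hE]; ring⟩
  rw [C_dvd_iff_dvd_coeff]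
  intro i
  apply X_pow_dvd_of_coe
  have hF' : (F.map (expand k s).toRingHom).map (coeToPowerSeries.ringHom (R := k)) =
      ∏ i : Fin l.length, (X - C l[i]) := by
    have h1 : ∏ i : Fin l.length, (X - C l[i]) = (l.map fun u => X - C u).prod := by
      rw [← List.prod_ofFn, ← List.ofFn_getElem_eq_map]
      rfl
    rw [h1]
    refine Eq.trans ?_ (hus.trans (by simp))
    ext1 j
    simp only [coeff_map]
    exact coe_expand s hs _
  -- Modulo `t ^ N` every root equals its truncation, so the two products agree factor by factor.
  set I : Ideal (PowerSeries k) := Ideal.span {PowerSeries.X ^ N}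
  have hmod : ((F.map (expand k s).toRingHom -
      ∏ i : Fin l.length, (X - C (PowerSeries.trunc N l[i]))).map
        (coeToPowerSeries.ringHom (R := k))).map (Ideal.Quotient.mk I) = 0 := by
    rw [Polynomial.map_sub, hF', Polynomial.map_sub, Polynomial.map_prod, Polynomial.map_prod,
      Polynomial.map_prod, sub_eq_zero]
    refine Finset.prod_congr rfl fun j _ => ?_
    simp only [Polynomial.map_sub, map_X, map_C]
    congr 2
    rw [Ideal.Quotient.eq, Ideal.mem_span_singleton]
    exact X_pow_dvd_sub_trunc _ _
  have := congrArg (fun p => p.coeff i) hmod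
  simp only [coeff_map, coeff_zero] at this
  rw [Ideal.Quotient.eq_zero_iff_mem, Ideal.mem_span_singleton] at this
  exact this

/-- In the approximate factorization, the approximate roots may be taken to be polynomials in
`t ^ r`. -/
theorem exists_prod_expand_add [IsAlgClosed k] [CharZero k] (F : k[X][X]) (hF : F.Monic) :
    ∃ s : ℕ, s ≠ 0 ∧ ∀ r ≠ 0, ∀ N : ℕ, ∃ (u : Fin F.natDegree → k[X]) (E : k[X][X]),
      F.map (expand k (s * r)).toRingHom =
        ∏ i, (X - C (expand k r (u i))) + C (X ^ N) * E := by
  obtain ⟨s, hs, h⟩ := exists_prod_add F hF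
  refine ⟨s, hs, fun r hr N => ?_⟩
  obtain ⟨u, E, hE⟩ := h N
  -- The substitution turns the error `t ^ N` into `t ^ (r * N)`; the surplus is absorbed in the
  -- cofactor.
  refine ⟨u, C (X ^ (r * N - N)) * E.map (expand k r).toRingHom, ?_⟩
  have h1 : F.map (expand k (s * r)).toRingHom =
      (F.map (expand k s).toRingHom).map (expand k r).toRingHom := by
    ext1 i
    simp only [coeff_map]
    rw [mul_comm s r]
    exact expand_mul r s _
  have h2 : N + (r * N - N) = r * N :=
    Nat.add_sub_cancel' (Nat.le_mul_of_pos_left N (Nat.pos_of_ne_zero hr))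
  rw [h1, hE, Polynomial.map_add, Polynomial.map_mul, Polynomial.map_prod, ← mul_assoc,
    ← C_mul, ← pow_add, h2]
  simp [pow_mul]

end Puiseux

/-! ### Orders and lowest coefficients of a product of linear factors under zooming. -/

namespace NewtonChain

open Polynomial

/-- The minimum of `k` and the order of vanishing of `v` at `0`. -/
noncomputable def truncOrder (k : ℕ) (v : ℂ[X]) : ℕ :=
  open Classical in if X ^ k ∣ v then k else v.natTrailingDegree

/-- The value at `t = 0` of `(t ^ k * ξ + v(t)) / t ^ truncOrder k v`, as a polynomial in `ξ`. -/
noncomputable def residueFactor (k : ℕ) (v : ℂ[X]) : ℂ[X] :=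
  open Classical in (if X ^ k ∣ v then X else 0) + C (v.coeff (truncOrder k v))

theorem truncOrder_of_dvd {k : ℕ} {v : ℂ[X]} (h : X ^ k ∣ v) : truncOrder k v = k := if_pos h

theorem truncOrder_of_not_dvd {k : ℕ} {v : ℂ[X]} (h : ¬ X ^ k ∣ v) :
    truncOrder k v = v.natTrailingDegree := if_neg h

theorem residueFactor_of_dvd {k : ℕ} {v : ℂ[X]} (h : X ^ k ∣ v) :
    residueFactor k v = X + C (v.coeff k) := by
  rw [residueFactor, if_pos h, truncOrder_of_dvd h]

theorem residueFactor_of_not_dvd {k : ℕ} {v : ℂ[X]} (h : ¬ X ^ k ∣ v) :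
    residueFactor k v = C v.trailingCoeff := by
  rw [residueFactor, if_neg h, truncOrder_of_not_dvd h, zero_add, trailingCoeff]

theorem ne_zero_of_not_dvd {k : ℕ} {v : ℂ[X]} (h : ¬ X ^ k ∣ v) : v ≠ 0 := by
  rintro rfl
  exact h (dvd_zero _)

theorem X_pow_natTrailingDegree_dvd (v : ℂ[X]) : X ^ v.natTrailingDegree ∣ v := by
  rw [X_pow_dvd_iff]
  exact fun d hd => coeff_eq_zero_of_lt_natTrailingDegree hd

theorem natTrailingDegree_lt_of_not_dvd {k : ℕ} {v : ℂ[X]} (h : ¬ X ^ k ∣ v) :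
    v.natTrailingDegree < k := by
  by_contra hk
  exact h ((pow_dvd_pow _ (not_lt.1 hk)).trans (X_pow_natTrailingDegree_dvd v))

theorem X_pow_truncOrder_dvd (k : ℕ) (v : ℂ[X]) : X ^ truncOrder k v ∣ v := by
  by_cases h : X ^ k ∣ v
  · rwa [truncOrder_of_dvd h]
  · rw [truncOrder_of_not_dvd h]
    exact X_pow_natTrailingDegree_dvd v

theorem truncOrder_le (k : ℕ) (v : ℂ[X]) : truncOrder k v ≤ k := by
  by_cases h : X ^ k ∣ v
  · rw [truncOrder_of_dvd h]
  · rw [truncOrder_of_not_dvd h]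
    exact (natTrailingDegree_lt_of_not_dvd h).le

theorem residueFactor_ne_zero (k : ℕ) (v : ℂ[X]) : residueFactor k v ≠ 0 := by
  by_cases h : X ^ k ∣ v
  · rw [residueFactor_of_dvd h]
    exact X_add_C_ne_zero _
  · rw [residueFactor_of_not_dvd h, Ne, C_eq_zero, trailingCoeff_eq_zero]
    exact ne_zero_of_not_dvd h

theorem natTrailingDegree_X_add_C {c : ℂ} (hc : c ≠ 0) :
    (X + C c : ℂ[X]).natTrailingDegree = 0 :=
  natTrailingDegree_eq_zero_of_constantCoeff_ne_zero (by simpa using hc)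

/-- The passage from `k` to `k + 1`: the leading monomial of the new residue factor is the trailing
monomial of the old one, whose degree is the increase of the order. -/
theorem residueFactor_succ (k : ℕ) (v : ℂ[X]) :
    (residueFactor (k + 1) v).natDegree = (residueFactor k v).natTrailingDegree ∧
    (residueFactor (k + 1) v).leadingCoeff = (residueFactor k v).trailingCoeff ∧
    truncOrder (k + 1) v = truncOrder k v + (residueFactor k v).natTrailingDegree := by
  by_cases h1 : X ^ (k + 1) ∣ v
  · have h : X ^ k ∣ v := (pow_dvd_pow _ (Nat.le_succ k)).trans h1
    have hc : v.coeff k = 0 := X_pow_dvd_iff.1 h1 k (Nat.lt_succ_self k)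
    rw [residueFactor_of_dvd h1, residueFactor_of_dvd h, truncOrder_of_dvd h1,
      truncOrder_of_dvd h, hc]
    simp [trailingCoeff]
  · by_cases h : X ^ k ∣ v
    · have hc : v.coeff k ≠ 0 := by
        intro hc
        apply h1
        rw [X_pow_dvd_iff] at h ⊢
        intro d hd
        rcases Nat.lt_succ_iff_lt_or_eq.1 hd with hd | rfl
        · exact h d hd
        · exact hc
      have hk : v.natTrailingDegree = k := by
        refine le_antisymm (natTrailingDegree_le_of_ne_zero hc) ?_
        exact le_natTrailingDegree (ne_zero_of_not_dvd h1) (X_pow_dvd_iff.1 h)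
      rw [residueFactor_of_not_dvd h1, residueFactor_of_dvd h, truncOrder_of_not_dvd h1,
        truncOrder_of_dvd h, natTrailingDegree_X_add_C hc, trailingCoeff, trailingCoeff,
        natTrailingDegree_X_add_C hc, hk]
      simp
    · rw [residueFactor_of_not_dvd h1, residueFactor_of_not_dvd h, truncOrder_of_not_dvd h1,
        truncOrder_of_not_dvd h]
      simp [trailingCoeff]

theorem residueFactor_zero (v : ℂ[X]) : residueFactor 0 v = X + C (v.coeff 0) :=
  residueFactor_of_dvd (by simp)

/-- Together with `residueFactor_ne_zero` this makes `truncOrder` the exact order in `t` of `t ^ k *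
ξ + v`. -/
theorem exists_factor (k : ℕ) (v : ℂ[X]) :
    ∃ l : ℂ[X][X], C (X ^ k) * X + C v = C (X ^ truncOrder k v) * l ∧
      l.map (evalRingHom 0) = residueFactor k v := by
  obtain ⟨b, hb⟩ := X_pow_truncOrder_dvd k v
  have hb0 : b.coeff 0 = v.coeff (truncOrder k v) := by
    generalize truncOrder k v = n at hb
    rw [hb]
    simp [coeff_X_pow_mul']
  refine ⟨C (X ^ (k - truncOrder k v)) * X + C b, ?_, ?_⟩
  · rw [mul_add, ← mul_assoc, ← C_mul, ← C_mul, ← pow_add,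
      Nat.add_sub_cancel' (truncOrder_le k v), ← hb]
  · simp only [Polynomial.map_add, Polynomial.map_mul, map_C, map_X, coe_evalRingHom, eval_pow,
      eval_X]
    rw [← coeff_zero_eq_eval_zero, hb0]
    by_cases h : X ^ k ∣ v
    · rw [residueFactor_of_dvd h, truncOrder_of_dvd h]
      simp
    · rw [residueFactor_of_not_dvd h, truncOrder_of_not_dvd h, zero_pow, trailingCoeff]
      · simp
      · have := natTrailingDegree_lt_of_not_dvd h
        omega

section Product

variable {ι : Type*} [Fintype ι]

/-- The order in `t` of `∏ i, (t ^ k * ξ + v i)`. -/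
noncomputable def totalOrder (v : ι → ℂ[X]) (k : ℕ) : ℕ := ∑ i, truncOrder k (v i)

/-- The lowest order coefficient of `A * ∏ i, (t ^ k * ξ + v i)`, as a polynomial in `ξ`. -/
noncomputable def residuePoly (A : ℂ) (v : ι → ℂ[X]) (k : ℕ) : ℂ[X] :=
  C A * ∏ i, residueFactor k (v i)

variable (A : ℂ) (v : ι → ℂ[X])

theorem totalOrder_zero : totalOrder v 0 = 0 := by
  simp [totalOrder, truncOrder_of_dvd]

theorem natTrailingDegree_prod {κ : Type*} (s : Finset κ) (f : κ → ℂ[X])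
    (hf : ∀ i ∈ s, f i ≠ 0) :
    (∏ i ∈ s, f i).natTrailingDegree = ∑ i ∈ s, (f i).natTrailingDegree := by
  classical
  induction s using Finset.induction_on with
  | empty => simp
  | insert a s ha ih =>
    have h1 : ∀ i ∈ s, f i ≠ 0 := fun i hi => hf i (Finset.mem_insert_of_mem hi)
    rw [Finset.prod_insert ha, Finset.sum_insert ha,
      natTrailingDegree_mul (hf a (Finset.mem_insert_self _ _)) (Finset.prod_ne_zero_iff.2 h1),
      ih h1]

theorem trailingCoeff_prod {κ : Type*} (s : Finset κ) (f : κ → ℂ[X]) :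
    (∏ i ∈ s, f i).trailingCoeff = ∏ i ∈ s, (f i).trailingCoeff := by
  classical
  induction s using Finset.induction_on with
  | empty => simp [trailingCoeff]
  | insert a s ha ih => rw [Finset.prod_insert ha, Finset.prod_insert ha, trailingCoeff_mul, ih]

theorem trailingCoeff_C (c : ℂ) : (C c : ℂ[X]).trailingCoeff = c := by simp [trailingCoeff]

variable {A}

theorem residuePoly_ne_zero (hA : A ≠ 0) (k : ℕ) : residuePoly A v k ≠ 0 :=
  mul_ne_zero (C_ne_zero.2 hA)
    (Finset.prod_ne_zero_iff.2 fun i _ => residueFactor_ne_zero k (v i))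

theorem natDegree_residuePoly (hA : A ≠ 0) (k : ℕ) :
    (residuePoly A v k).natDegree = ∑ i, (residueFactor k (v i)).natDegree := by
  rw [residuePoly, natDegree_C_mul hA, natDegree_prod _ _ fun i _ => residueFactor_ne_zero k (v i)]

theorem natTrailingDegree_residuePoly (hA : A ≠ 0) (k : ℕ) :
    (residuePoly A v k).natTrailingDegree = ∑ i, (residueFactor k (v i)).natTrailingDegree := by
  rw [residuePoly, natTrailingDegree_mul (C_ne_zero.2 hA)
    (Finset.prod_ne_zero_iff.2 fun i _ => residueFactor_ne_zero k (v i)), natTrailingDegree_C,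
    zero_add, natTrailingDegree_prod _ _ fun i _ => residueFactor_ne_zero k (v i)]

theorem natDegree_residuePoly_zero (hA : A ≠ 0) :
    (residuePoly A v 0).natDegree = Fintype.card ι := by
  rw [natDegree_residuePoly v hA]
  simp [residueFactor_zero]

theorem leadingCoeff_residuePoly_zero : (residuePoly A v 0).leadingCoeff = A := by
  rw [residuePoly, leadingCoeff_mul, leadingCoeff_C, leadingCoeff_prod]
  simp [residueFactor_zero]

theorem natDegree_residuePoly_succ (hA : A ≠ 0) (k : ℕ) :
    (residuePoly A v (k + 1)).natDegree = (residuePoly A v k).natTrailingDegree := by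
  rw [natDegree_residuePoly v hA, natTrailingDegree_residuePoly v hA]
  exact Finset.sum_congr rfl fun i _ => (residueFactor_succ k (v i)).1

theorem leadingCoeff_residuePoly_succ (k : ℕ) :
    (residuePoly A v (k + 1)).leadingCoeff = (residuePoly A v k).trailingCoeff := by
  rw [residuePoly, leadingCoeff_mul, leadingCoeff_C, leadingCoeff_prod, residuePoly,
    trailingCoeff_mul, trailingCoeff_C, trailingCoeff_prod]
  congr 1
  exact Finset.prod_congr rfl fun i _ => (residueFactor_succ k (v i)).2.1

theorem totalOrder_succ (hA : A ≠ 0) (k : ℕ) :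
    totalOrder v (k + 1) = totalOrder v k + (residuePoly A v k).natTrailingDegree := by
  rw [natTrailingDegree_residuePoly v hA, totalOrder, totalOrder, ← Finset.sum_add_distrib]
  exact Finset.sum_congr rfl fun i _ => (residueFactor_succ k (v i)).2.2

theorem exists_lift_residuePoly (A : ℂ) (k : ℕ) :
    ∃ g : ℂ[X][X], C (C A) * ∏ i, (C (X ^ k) * X + C (v i)) = C (X ^ totalOrder v k) * g ∧
      g.map (evalRingHom 0) = residuePoly A v k := by
  choose l hl hl0 using fun i => exists_factor k (v i)
  refine ⟨C (C A) * ∏ i, l i, ?_, ?_⟩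
  · rw [Finset.prod_congr rfl fun i _ => hl i, Finset.prod_mul_distrib, totalOrder,
      ← Finset.prod_pow_eq_pow_sum, map_prod]
    ring
  · rw [Polynomial.map_mul, Polynomial.map_prod, Finset.prod_congr rfl fun i _ => hl0 i,
      residuePoly]
    simp

/-- Each factor contributing to the degree in `ξ` contributes `k` to the order. So an order below
`k` leaves a residue polynomial of degree zero. -/
theorem mul_natDegree_le_totalOrder (hA : A ≠ 0) (k : ℕ) :
    k * (residuePoly A v k).natDegree ≤ totalOrder v k := by
  rw [natDegree_residuePoly v hA, totalOrder, Finset.mul_sum]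
  refine Finset.sum_le_sum fun i _ => ?_
  by_cases h : X ^ k ∣ v i
  · rw [residueFactor_of_dvd h, truncOrder_of_dvd h]
    simp
  · rw [residueFactor_of_not_dvd h]
    simp

/-- If the orders of the `v i` are divisible by `S`, which is divisible by all numbers up to the
number of the `v i`, then the order does not jump over a multiple of `S`. -/
theorem totalOrder_hits {S D k : ℕ} (hv : ∀ i, v i ≠ 0 → S ∣ (v i).natTrailingDegree)
    (hS : (Fintype.card ι).factorial ∣ S) (hD : S ∣ D) (hlt : totalOrder v k < D)
    (hle : D ≤ totalOrder v (k + 1)) : totalOrder v (k + 1) = D := by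
  classical
  have hA : (1 : ℂ) ≠ 0 := one_ne_zero
  have hsucc := totalOrder_succ v hA k
  set μ := (residuePoly 1 v k).natTrailingDegree with hμ
  have hμpos : 0 < μ := by omega
  have hμd : μ = ∑ i, (residueFactor (k + 1) (v i)).natDegree := by
    rw [hμ, ← natDegree_residuePoly_succ v hA, natDegree_residuePoly v hA]
  have hμcard : μ ≤ Fintype.card ι := by
    rw [hμd, Fintype.card_eq_sum_ones]
    refine Finset.sum_le_sum fun i _ => ?_
    by_cases h : X ^ (k + 1) ∣ v i
    · rw [residueFactor_of_dvd h]; simp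
    · rw [residueFactor_of_not_dvd h]; simp
  have hμS : μ ∣ S := (Nat.dvd_factorial hμpos hμcard).trans hS
  -- Exactly `μ` factors still move with `ξ`, each of order `k + 1`; the others have orders
  -- divisible by `S`, hence by `μ`. The last step to `k + 1` raises the order by `μ`, so no
  -- multiple of `μ`, in particular not `D`, lies strictly between the two orders.
  have hdvd : μ ∣ totalOrder v (k + 1) := by
    have hsplit : totalOrder v (k + 1) = (k + 1) * μ +
        ∑ i, if X ^ (k + 1) ∣ v i then 0 else (v i).natTrailingDegree := by
      rw [hμd, Finset.mul_sum, totalOrder, ← Finset.sum_add_distrib]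
      refine Finset.sum_congr rfl fun i _ => ?_
      by_cases h : X ^ (k + 1) ∣ v i
      · rw [truncOrder_of_dvd h, residueFactor_of_dvd h, if_pos h]; simp
      · rw [truncOrder_of_not_dvd h, residueFactor_of_not_dvd h, if_neg h]; simp
    rw [hsplit]
    refine dvd_add (dvd_mul_left _ _) (Finset.dvd_sum fun i _ => ?_)
    split_ifs with h
    · exact dvd_zero _
    · exact hμS.trans (hv i (ne_zero_of_not_dvd h))
  obtain ⟨a, ha⟩ := hdvd
  obtain ⟨b, hb⟩ := hμS.trans hD
  have h1 : μ * a < μ * (b + 1) := by rw [mul_add, ← hb, ← ha]; omega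
  have h2 : μ * b ≤ μ * a := by omega
  have h3 := Nat.lt_of_mul_lt_mul_left h1
  have h4 := Nat.le_of_mul_le_mul_left h2 hμpos
  rw [ha, hb, show a = b by omega]

end Product

end NewtonChain

/-! ### Vanishing weighted Wronskians and pairs of chains. -/

namespace NewtonChain

open Polynomial

theorem coeff_X_mul_derivative (r : ℂ[X]) (n : ℕ) :
    (X * derivative r).coeff n = n * r.coeff n := by
  rcases n with _ | n
  · simp
  · rw [coeff_X_mul, coeff_derivative]
    push_cast
    ring

theorem natDegree_X_mul_derivative_le (r : ℂ[X]) : (X * derivative r).natDegree ≤ r.natDegree := by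
  rw [natDegree_le_iff_coeff_eq_zero]
  intro n hn
  rw [coeff_X_mul_derivative, coeff_eq_zero_of_natDegree_lt hn, mul_zero]

/-- The combination `r` cancelling the leading terms satisfies the same equation and has smaller
degree than `w`. If `r ≠ 0`, comparing top coefficients of `X * r' * w = X * r * w'` gives equal
degrees, a contradiction. -/
theorem proportional_of_derivative_mul_eq {u w : ℂ[X]} (hw : w ≠ 0)
    (hdeg : u.natDegree = w.natDegree) (h : derivative u * w = u * derivative w) :
    C w.leadingCoeff * u = C u.leadingCoeff * w := by
  set r := C w.leadingCoeff * u - C u.leadingCoeff * w with hr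
  have hrw : derivative r * w = r * derivative w := by
    simp only [hr, derivative_sub, derivative_mul, derivative_C]
    linear_combination C w.leadingCoeff * h
  by_contra hne
  have hr0 : r ≠ 0 := sub_ne_zero.2 hne
  have hwl : w.leadingCoeff ≠ 0 := leadingCoeff_ne_zero.2 hw
  have hlt : r.natDegree < w.natDegree := by
    have hle : r.natDegree ≤ w.natDegree := by
      refine (natDegree_sub_le _ _).trans (max_le ?_ ?_)
      · exact (natDegree_C_mul_le _ _).trans hdeg.le
      · exact natDegree_C_mul_le _ _
    refine lt_of_le_of_ne hle fun heq => ?_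
    have : r.coeff r.natDegree = 0 := by
      rw [heq, hr, coeff_sub, coeff_C_mul, coeff_C_mul, coeff_natDegree, ← hdeg, coeff_natDegree]
      ring
    exact hr0 (leadingCoeff_eq_zero.1 this)
  have h1 : X * derivative r * w = r * (X * derivative w) := by linear_combination X * hrw
  have h2 := congrArg (fun f => f.coeff (r.natDegree + w.natDegree)) h1
  rw [coeff_mul_add_eq_of_natDegree_le (natDegree_X_mul_derivative_le r) le_rfl,
    coeff_mul_add_eq_of_natDegree_le le_rfl (natDegree_X_mul_derivative_le w), coeff_X_mul_derivative,
    coeff_X_mul_derivative, coeff_natDegree, coeff_natDegree] at h2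
  have h3 : ((r.natDegree : ℂ) - w.natDegree) * (r.leadingCoeff * w.leadingCoeff) = 0 := by
    linear_combination h2
  rcases mul_eq_zero.1 h3 with h4 | h4
  · exact hlt.ne (by exact_mod_cast sub_eq_zero.1 h4)
  · exact mul_ne_zero (leadingCoeff_ne_zero.2 hr0) hwl h4

/-- The weighted equation says that `p ^ e / q ^ d` has zero derivative. -/
theorem pow_proportional {p q : ℂ[X]} {d e M : ℕ} (hd : 0 < d) (he : 0 < e) (hq : q ≠ 0)
    (hpd : p.natDegree = d * M) (hqd : q.natDegree = e * M)
    (h : C (d : ℂ) * p * derivative q = C (e : ℂ) * q * derivative p) :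
    C (q.leadingCoeff ^ d) * p ^ e = C (p.leadingCoeff ^ e) * q ^ d := by
  rw [← leadingCoeff_pow, ← leadingCoeff_pow]
  refine proportional_of_derivative_mul_eq (pow_ne_zero _ hq) ?_ ?_
  · rw [natDegree_pow, natDegree_pow, hpd, hqd]; ring
  · obtain ⟨d, rfl⟩ := Nat.exists_eq_succ_of_ne_zero hd.ne'
    obtain ⟨e, rfl⟩ := Nat.exists_eq_succ_of_ne_zero he.ne'
    rw [derivative_pow_succ, derivative_pow_succ]
    simp only [Nat.succ_eq_add_one, Nat.cast_add, Nat.cast_one] at h ⊢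
    linear_combination (-p ^ e * q ^ d) * h

theorem trailingCoeff_pow' (p : ℂ[X]) (n : ℕ) : (p ^ n).trailingCoeff = p.trailingCoeff ^ n := by
  simpa using trailingCoeff_prod (Finset.range n) (fun _ => p)

theorem natTrailingDegree_pow' {p : ℂ[X]} (hp : p ≠ 0) (n : ℕ) :
    (p ^ n).natTrailingDegree = n * p.natTrailingDegree := by
  simpa using natTrailingDegree_prod (Finset.range n) (fun _ => p) (fun _ _ => hp)

theorem natTrailingDegree_eq_zero_of_eval_ne_zero {p : ℂ[X]} (h : p.eval 0 ≠ 0) :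
    p.natTrailingDegree = 0 :=
  natTrailingDegree_eq_zero_of_constantCoeff_ne_zero (by
    rwa [constantCoeff_apply, coeff_zero_eq_eval_zero])

/-- A sequence of nonzero polynomials such that the leading monomial of each is the trailing
monomial of its predecessor, with the accumulated degrees `α`. -/
structure IsChain (A : ℂ) (n : ℕ) (p : ℕ → ℂ[X]) (α : ℕ → ℕ) : Prop where
  ne_zero : ∀ k, p k ≠ 0
  natDegree_zero : (p 0).natDegree = n
  leadingCoeff_zero : (p 0).leadingCoeff = A
  order_zero : α 0 = 0
  natDegree_succ : ∀ k, (p (k + 1)).natDegree = (p k).natTrailingDegree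
  leadingCoeff_succ : ∀ k, (p (k + 1)).leadingCoeff = (p k).trailingCoeff
  order_succ : ∀ k, α (k + 1) = α k + (p k).natTrailingDegree

theorem isChain_residuePoly {ι : Type*} [Fintype ι] {A : ℂ} (hA : A ≠ 0) (v : ι → ℂ[X]) :
    IsChain A (Fintype.card ι) (residuePoly A v) (totalOrder v) where
  ne_zero := residuePoly_ne_zero v hA
  natDegree_zero := natDegree_residuePoly_zero v hA
  leadingCoeff_zero := leadingCoeff_residuePoly_zero v
  order_zero := totalOrder_zero v
  natDegree_succ := natDegree_residuePoly_succ v hA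
  leadingCoeff_succ := leadingCoeff_residuePoly_succ v
  order_succ := totalOrder_succ v hA

namespace IsChain

variable {A : ℂ} {n : ℕ} {p : ℕ → ℂ[X]} {α : ℕ → ℕ}

theorem monotone (h : IsChain A n p α) : Monotone α :=
  monotone_nat_of_le_succ fun k => by rw [h.order_succ]; exact Nat.le_add_right _ _

/-- A member not vanishing at `0` is followed only by constants, so the order freezes.
Contrapositively, members vanish at `0` as long as a larger order is still to be reached. -/
theorem order_eq_of_natTrailingDegree_eq_zero (h : IsChain A n p α) {k : ℕ}
    (hk : (p k).natTrailingDegree = 0) (j : ℕ) : α (k + j) = α k := by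
  suffices α (k + j) = α k ∧ (p (k + j)).natTrailingDegree = 0 from this.1
  induction j with
  | zero => exact ⟨rfl, hk⟩
  | succ j ih =>
    refine ⟨by rw [← add_assoc, h.order_succ, ih.1, ih.2, add_zero], ?_⟩
    have h1 := h.natDegree_succ (k + j)
    rw [ih.2] at h1
    have h2 := natTrailingDegree_le_natDegree (p (k + j + 1))
    rw [← add_assoc]
    omega

theorem natTrailingDegree_ne_zero (h : IsChain A n p α) {k j D : ℕ} (hk : α k < D)
    (hj : D ≤ α j) : (p k).natTrailingDegree ≠ 0 := by
  intro h0
  rcases le_total j k with hjk | hjk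
  · have := h.monotone hjk
    omega
  · have := h.order_eq_of_natTrailingDegree_eq_zero h0 (j - k)
    rw [Nat.add_sub_cancel' hjk] at this
    omega

end IsChain

theorem exists_mul_of_coprime {d e a b : ℕ} (hde : Nat.Coprime d e) (hd : 0 < d)
    (h : e * a = d * b) : ∃ M, a = d * M ∧ b = e * M := by
  obtain ⟨M, hM⟩ : d ∣ a := hde.dvd_of_dvd_mul_left ⟨b, h⟩
  refine ⟨M, hM, ?_⟩
  subst hM
  exact Nat.eq_of_mul_eq_mul_left hd (by rw [← h]; ring)

/-- Two chains whose members have constant weighted Wronskian have proportional degrees and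
orders, until the orders reach `d * L` and `e * L`. -/
theorem exists_dicritical {A B : ℂ} {d e K L : ℕ} (hde : Nat.Coprime d e) (hd : 0 < d)
    (he : 0 < e) (hL : 0 < L) {p q : ℕ → ℂ[X]} {α β : ℕ → ℕ}
    (hp : IsChain A (d * K) p α) (hq : IsChain B (e * K) q β)
    (hW : ∀ k, α k < d * L → β k < e * L → ∃ c : ℂ,
      C ((d * L : ℂ) - α k) * p k * derivative (q k) -
        C ((e * L : ℂ) - β k) * q k * derivative (p k) = C c)
    (hα : ∃ k, d * L ≤ α k) (hβ : ∃ k, e * L ≤ β k)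
    (hhit : ∀ k, α k < d * L → d * L ≤ α (k + 1) → α (k + 1) = d * L) :
    ∃ k M, 1 ≤ M ∧ α k = d * L ∧ β k = e * L ∧ (p k).natDegree = d * M ∧
      (q k).natDegree = e * M ∧
      B ^ d * (p k).leadingCoeff ^ e = A ^ e * (q k).leadingCoeff ^ d := by
  classical
  have hmin : ∀ j < Nat.find hα, α j < d * L := fun j hj => not_le.1 (Nat.find_min hα hj)
  have hspec := Nat.find_spec hα
  -- The invariant is carried up to the first index where `α` reaches its target. The relation
  -- between leading coefficients is what later allows both to be normalized by one rescaling.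
  have inv : ∀ k ≤ Nat.find hα, ∃ M, (p k).natDegree = d * M ∧ (q k).natDegree = e * M ∧
      e * α k = d * β k ∧
      B ^ d * (p k).leadingCoeff ^ e = A ^ e * (q k).leadingCoeff ^ d := by
    intro k
    induction k with
    | zero =>
      intro _
      refine ⟨K, hp.natDegree_zero, hq.natDegree_zero, ?_, ?_⟩
      · rw [hp.order_zero, hq.order_zero]; ring
      · rw [hp.leadingCoeff_zero, hq.leadingCoeff_zero]; ring
    | succ k ih =>
      intro hk
      obtain ⟨M, hpM, hqM, hαβ, hlc⟩ := ih (by omega)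
      have hαk : α k < d * L := hmin k (by omega)
      have hβk : β k < e * L := by
        refine Nat.lt_of_mul_lt_mul_left (a := d) ?_
        rw [← hαβ]
        calc e * α k < e * (d * L) := Nat.mul_lt_mul_of_pos_left hαk he
          _ = d * (e * L) := by ring
      obtain ⟨j, hj⟩ := hβ
      have hp0 := hp.natTrailingDegree_ne_zero hαk hspec
      have hq0 := hq.natTrailingDegree_ne_zero hβk hj
      obtain ⟨c, hc⟩ := hW k hαk hβk
      have hpe : (p k).eval 0 = 0 := by
        by_contra h
        exact hp0 (natTrailingDegree_eq_zero_of_eval_ne_zero h)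
      have hqe : (q k).eval 0 = 0 := by
        by_contra h
        exact hq0 (natTrailingDegree_eq_zero_of_eval_ne_zero h)
      -- Evaluate the Wronskian identity at `0`, where both polynomials vanish.
      have hc0 : c = 0 := by
        have := congrArg (eval 0) hc
        simpa [hpe, hqe] using this.symm
      have ha : ((d * L : ℂ) - α k) ≠ 0 := by
        rw [sub_ne_zero]
        exact_mod_cast hαk.ne'
      -- The remaining orders are in the ratio `d : e`, so the weights can be replaced by `d` and
      -- `e`.
      have hab : (d : ℂ) * ((e * L : ℂ) - β k) = e * ((d * L : ℂ) - α k) := by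
        have : (e : ℂ) * α k = d * β k := by exact_mod_cast hαβ
        linear_combination this
      have hWr : C (d : ℂ) * p k * derivative (q k) = C (e : ℂ) * q k * derivative (p k) := by
        refine mul_left_cancel₀ (C_ne_zero.2 ha) ?_
        have hab' := congrArg (C : ℂ → ℂ[X]) hab
        rw [C_mul, C_mul] at hab'
        rw [hc0, C_0] at hc
        linear_combination C (d : ℂ) * hc + (q k * derivative (p k)) * hab'
      have hpow := pow_proportional hd he (hq.ne_zero k) hpM hqM hWr
      have hlq : (q k).leadingCoeff ^ d ≠ 0 :=
        pow_ne_zero _ (leadingCoeff_ne_zero.2 (hq.ne_zero k))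
      have hlp : (p k).leadingCoeff ^ e ≠ 0 :=
        pow_ne_zero _ (leadingCoeff_ne_zero.2 (hp.ne_zero k))
      have htr := congrArg natTrailingDegree hpow
      rw [natTrailingDegree_mul (C_ne_zero.2 hlq) (pow_ne_zero _ (hp.ne_zero k)),
        natTrailingDegree_mul (C_ne_zero.2 hlp) (pow_ne_zero _ (hq.ne_zero k)),
        natTrailingDegree_C, natTrailingDegree_C, zero_add, zero_add,
        natTrailingDegree_pow' (hp.ne_zero k), natTrailingDegree_pow' (hq.ne_zero k)] at htr
      have htc := congrArg trailingCoeff hpow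
      rw [trailingCoeff_mul, trailingCoeff_mul, trailingCoeff_C, trailingCoeff_C,
        trailingCoeff_pow', trailingCoeff_pow'] at htc
      obtain ⟨M', hM1, hM2⟩ := exists_mul_of_coprime hde hd htr
      refine ⟨M', by rw [hp.natDegree_succ, hM1], by rw [hq.natDegree_succ, hM2], ?_, ?_⟩
      · rw [hp.order_succ, hq.order_succ, mul_add, mul_add, hαβ, htr]
      · rw [hp.leadingCoeff_succ, hq.leadingCoeff_succ]
        refine mul_left_cancel₀ hlq ?_
        linear_combination B ^ d * htc + (q k).trailingCoeff ^ d * hlc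
  obtain ⟨M, hpM, hqM, hαβ, hlc⟩ := inv _ le_rfl
  obtain ⟨j, hj⟩ : ∃ j, Nat.find hα = j + 1 := by
    refine Nat.exists_eq_succ_of_ne_zero fun h => ?_
    rw [h, hp.order_zero] at hspec
    have := Nat.mul_pos hd hL
    omega
  have hjlt := hmin j (by omega)
  rw [hj] at hspec hpM hqM hαβ hlc
  have heq := hhit j hjlt hspec
  refine ⟨j + 1, M, ?_, heq, ?_, hpM, hqM, hlc⟩
  -- With `M = 0` the last step would not have raised `α` to its target.
  · have h1 := hp.order_succ j
    have h2 := hp.natDegree_succ j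
    rw [Nat.one_le_iff_ne_zero]
    rintro rfl
    omega
  · refine Nat.eq_of_mul_eq_mul_left hd ?_
    rw [← hαβ, heq]
    ring

end NewtonChain

/-! ### Coordinates at infinity and the Jacobian as a weighted Wronskian. -/

namespace PlanePoly

open Polynomial

/-- All monomials of `P` have degree at most `n`. -/
def DegreeLE (P : Poly) (n : ℕ) : Prop := ∀ s : Fin 2 →₀ ℕ, P.coeff s ≠ 0 → s 0 + s 1 ≤ n

theorem degreeLE_of_totalDegree_le {P : Poly} {n : ℕ} (h : P.totalDegree ≤ n) :
    DegreeLE P n := by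
  intro s hs
  have := (MvPolynomial.le_totalDegree (MvPolynomial.mem_support_iff.2 hs)).trans h
  rwa [Finsupp.sum_fintype _ _ (by simp), Fin.sum_univ_two] at this

theorem DegreeLE.pderiv {P : Poly} {n : ℕ} (h : DegreeLE P n) (i : Fin 2) :
    DegreeLE (MvPolynomial.pderiv i P) (n - 1) := by
  intro s hs
  rw [MvPolynomial.coeff_pderiv] at hs
  have h1 : P.coeff (s + Finsupp.single i 1) ≠ 0 := by
    intro h0
    simp [h0] at hs
  have := h _ h1
  fin_cases i <;> simp at this <;> omega

/-- The polynomial `t ^ n * P (1 / t, Y / t)` in `t` and `Y`. -/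
noncomputable def dehomogenize (n : ℕ) : Poly →ₗ[ℂ] ℂ[X][X] :=
  (MvPolynomial.basisMonomials (Fin 2) ℂ).constr ℂ
    fun s => C (X ^ (n - s 0 - s 1)) * X ^ s 1

theorem dehomogenize_monomial (n : ℕ) (s : Fin 2 →₀ ℕ) (c : ℂ) :
    dehomogenize n (MvPolynomial.monomial s c) =
      C (C c * X ^ (n - s 0 - s 1)) * X ^ s 1 := by
  have h : MvPolynomial.monomial s c = c • MvPolynomial.basisMonomials (Fin 2) ℂ s := by
    simp [MvPolynomial.smul_monomial]
  rw [h, map_smul, dehomogenize, Module.Basis.constr_basis,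
    ← algebraMap_smul ℂ[X] c, algebraMap_eq, smul_eq_C_mul, C_mul, mul_assoc]

theorem dehomogenize_eq_sum (n : ℕ) (P : Poly) :
    dehomogenize n P =
      ∑ s ∈ P.support, C (C (P.coeff s) * X ^ (n - s 0 - s 1)) * X ^ s 1 := by
  conv_lhs => rw [P.as_sum, map_sum]
  exact Finset.sum_congr rfl fun s _ => dehomogenize_monomial n s _

/-- The degree bound keeps the natural-number subtraction in `dehomogenize` from truncating. -/
theorem evalEval_dehomogenize {P : Poly} {n : ℕ} (h : DegreeLE P n) {t : ℂ} (ht : t ≠ 0)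
    (Y : ℂ) : (dehomogenize n P).evalEval t Y =
      t ^ n * MvPolynomial.eval ![t⁻¹, t⁻¹ * Y] P := by
  rw [dehomogenize_eq_sum, evalEval_finsetSum, MvPolynomial.eval_eq', Finset.mul_sum]
  refine Finset.sum_congr rfl fun s hs => ?_
  have hs' := h s (MvPolynomial.mem_support_iff.1 hs)
  have hn : n = (n - s 0 - s 1) + s 0 + s 1 := by omega
  have hpow : t ^ n = t ^ (n - s 0 - s 1) * t ^ s 0 * t ^ s 1 := by
    rw [← pow_add, ← pow_add, ← hn]
  rw [hpow, Fin.prod_univ_two]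
  simp only [evalEval, eval_mul, eval_C, eval_pow, eval_X, Matrix.cons_val_zero,
    Matrix.cons_val_one, mul_pow, inv_pow]
  field_simp

/-- Evaluations at `t ≠ 0` determine a polynomial in two variables. -/
theorem ext_evalEval {F G : ℂ[X][X]} (h : ∀ t : ℂ, t ≠ 0 → ∀ Y, F.evalEval t Y = G.evalEval t Y) :
    F = G := by
  ext1 i
  have hmap : ∀ t : ℂ, t ≠ 0 → F.map (evalRingHom t) = G.map (evalRingHom t) := by
    intro t ht
    refine funext fun Y => ?_
    rw [map_evalRingHom_eval, map_evalRingHom_eval]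
    exact h t ht Y
  refine eq_of_infinite_eval_eq _ _ (Set.Infinite.mono (s := {0}ᶜ) ?_
    (Set.finite_singleton (0 : ℂ)).infinite_compl)
  intro t ht
  have := congrArg (fun p => p.coeff i) (hmap t ht)
  simpa using this

/-- The derivation `t * ∂/∂t` of `ℂ[t][Y]`. -/
noncomputable def eulerDeriv : Derivation ℂ ℂ[X][X] ℂ[X][X] :=
  LinearMap.compDer (PolynomialModule.equivPolynomialSelf (R := ℂ[X])).toLinearMap
    ((X : ℂ[X]) • derivative' (R := ℂ)).mapCoeffs

theorem coeff_eulerDeriv (F : ℂ[X][X]) (i : ℕ) :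
    (eulerDeriv F).coeff i = X * derivative (F.coeff i) := rfl

theorem eulerDeriv_C (a : ℂ[X]) : eulerDeriv (C a) = C (X * derivative a) := by
  ext1 i
  rw [coeff_eulerDeriv, coeff_C, coeff_C]
  split_ifs <;> simp

theorem eulerDeriv_X : eulerDeriv X = 0 := by
  ext1 i
  rw [coeff_eulerDeriv, coeff_X]
  split_ifs <;> simp

theorem eulerDeriv_X_pow (n : ℕ) : eulerDeriv (X ^ n) = 0 := by
  rw [Derivation.leibniz_pow, eulerDeriv_X]
  simp

theorem eulerDeriv_C_X_pow (a : ℕ) :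
    eulerDeriv (C (X ^ a)) = (a : ℂ[X][X]) * C (X ^ a) := by
  rw [eulerDeriv_C]
  rcases a with _ | a
  · simp
  · rw [derivative_X_pow, pow_succ]
    simp
    ring

theorem eulerDeriv_comp (F q : ℂ[X][X]) :
    eulerDeriv (F.comp q) = (eulerDeriv F).comp q + (derivative F).comp q * eulerDeriv q := by
  induction F using Polynomial.induction_on' with
  | add p r hp hr => simp only [add_comp, map_add, hp, hr]; ring
  | monomial n a =>
    rw [← C_mul_X_pow_eq_monomial, Derivation.leibniz, eulerDeriv_X_pow]
    simp only [mul_comp, C_comp, X_pow_comp, Derivation.leibniz, Derivation.leibniz_pow,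
      eulerDeriv_C, derivative_C_mul_X_pow]
    simp
    ring

theorem derivative_dehomogenize {P : Poly} {n : ℕ} (h : DegreeLE P n) :
    derivative (dehomogenize n P) = dehomogenize (n - 1) (MvPolynomial.pderiv 1 P) := by
  conv_lhs => rw [P.as_sum, map_sum, map_sum]
  conv_rhs => rw [P.as_sum, map_sum, map_sum]
  refine Finset.sum_congr rfl fun s hs => ?_
  have hs' := h s (MvPolynomial.mem_support_iff.1 hs)
  rw [MvPolynomial.pderiv_monomial, dehomogenize_monomial, dehomogenize_monomial,
    derivative_C_mul_X_pow]
  rcases Nat.eq_zero_or_pos (s 1) with h0 | h0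
  · simp [h0]
  · have e1 : (s - Finsupp.single (1 : Fin 2) 1 : Fin 2 →₀ ℕ) 0 = s 0 := by simp
    have e2 : (s - Finsupp.single (1 : Fin 2) 1 : Fin 2 →₀ ℕ) 1 = s 1 - 1 := by simp
    have e3 : n - 1 - s 0 - (s 1 - 1) = n - s 0 - s 1 := by omega
    rw [e1, e2, e3]
    simp only [C_mul, map_natCast]
    ring

/-- Chain rule for `P (1 / t, Y / t)`: the operator `t * ∂/∂t` acts as `-(x * P_x + y * P_y)`, and
the term `n * G` accounts for the factor `t ^ n`. -/
theorem eulerDeriv_dehomogenize {P : Poly} {n : ℕ} (h : DegreeLE P n) :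
    eulerDeriv (dehomogenize n P) - (n : ℂ[X][X]) * dehomogenize n P =
      -dehomogenize (n - 1) (MvPolynomial.pderiv 0 P) - X * derivative (dehomogenize n P) := by
  conv_lhs => rw [P.as_sum, map_sum, map_sum, Finset.mul_sum, ← Finset.sum_sub_distrib]
  conv_rhs => rw [P.as_sum, map_sum, map_sum, map_sum, map_sum, Finset.mul_sum,
    ← Finset.sum_neg_distrib, ← Finset.sum_sub_distrib]
  refine Finset.sum_congr rfl fun s hs => ?_
  have hs' := h s (MvPolynomial.mem_support_iff.1 hs)
  rw [MvPolynomial.pderiv_monomial, dehomogenize_monomial, dehomogenize_monomial,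
    derivative_C_mul_X_pow, C_mul, Derivation.leibniz, Derivation.leibniz, eulerDeriv_X_pow,
    eulerDeriv_C_X_pow, eulerDeriv_C, derivative_C]
  have hY : X * (C (C (MvPolynomial.coeff s P) * X ^ (n - s 0 - s 1) * (s 1 : ℂ[X])) *
      X ^ (s 1 - 1)) = (s 1 : ℂ[X][X]) * (C (C (MvPolynomial.coeff s P) *
        X ^ (n - s 0 - s 1)) * X ^ s 1) := by
    rcases Nat.eq_zero_or_pos (s 1) with h0 | h0
    · simp [h0]
    · obtain ⟨j, hj⟩ := Nat.exists_eq_succ_of_ne_zero h0.ne'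
      rw [hj]
      simp only [C_mul, map_natCast, Nat.succ_eq_add_one, Nat.add_sub_cancel, pow_succ]
      ring
  have hX : C (C (MvPolynomial.coeff s P * (s 0 : ℂ)) *
      X ^ (n - 1 -
        (s - Finsupp.single (0 : Fin 2) 1 : Fin 2 →₀ ℕ) 0 -
        (s - Finsupp.single (0 : Fin 2) 1 : Fin 2 →₀ ℕ) 1)) *
        X ^ (s - Finsupp.single (0 : Fin 2) 1 : Fin 2 →₀ ℕ) 1 =
      (s 0 : ℂ[X][X]) * (C (C (MvPolynomial.coeff s P) *
        X ^ (n - s 0 - s 1)) * X ^ s 1) := by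
    rcases Nat.eq_zero_or_pos (s 0) with h0 | h0
    · simp [h0]
    · have e1 : (s - Finsupp.single (0 : Fin 2) 1 : Fin 2 →₀ ℕ) 0 = s 0 - 1 := by simp
      have e2 : (s - Finsupp.single (0 : Fin 2) 1 : Fin 2 →₀ ℕ) 1 = s 1 := by simp
      have e3 : n - 1 - (s 0 - 1) - s 1 = n - s 0 - s 1 := by omega
      rw [e1, e2, e3]
      simp only [C_mul, map_natCast]
      ring
  rw [hX, hY]
  have hn : (n : ℂ[X][X]) =
      ((n - s 0 - s 1 : ℕ) : ℂ[X][X]) + (s 0 : ℂ[X][X]) + (s 1 : ℂ[X][X]) := by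
    have : n = (n - s 0 - s 1) + s 0 + s 1 := by omega
    exact_mod_cast congrArg (Nat.cast (R := ℂ[X][X])) this
  rw [hn]
  simp only [C_mul, smul_eq_mul, mul_zero, C_0, add_zero, zero_add]
  ring

/-- The Wronskian of `t ^ (-N) * G` and `t ^ (-N') * H` with respect to `t * ∂/∂t` and `∂/∂Y`,
multiplied by `t ^ (N + N')`. -/
noncomputable def weightedWronskian (N N' : ℂ) (G H : ℂ[X][X]) : ℂ[X][X] :=
  (eulerDeriv G - C (C N) * G) * derivative H - (eulerDeriv H - C (C N') * H) * derivative G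

theorem weightedWronskian_dehomogenize {P Q : Poly} {n n' : ℕ} (hP : DegreeLE P n)
    (hQ : DegreeLE Q n') {c : ℂ} (hJ : jacobian P Q = MvPolynomial.C c) :
    weightedWronskian n n' (dehomogenize n P) (dehomogenize n' Q) =
      C (C (-c) * X ^ (n - 1 + (n' - 1))) := by
  have h1 := eulerDeriv_dehomogenize hP
  have h2 := eulerDeriv_dehomogenize hQ
  have hn : ∀ k : ℕ, C (C (k : ℂ)) = (k : ℂ[X][X]) := fun k => by simp
  rw [weightedWronskian, hn, hn, h1, h2]
  have h3 : ∀ a b c d : ℂ[X][X], (-a - X * d) * b - (-c - X * b) * d = c * d - a * b := by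
    intros; ring
  rw [h3, derivative_dehomogenize hP, derivative_dehomogenize hQ]
  -- The terms containing `Y` have cancelled, leaving the Jacobian at `(1 / t, Y / t)` up to sign
  -- and a power of `t`.
  refine ext_evalEval fun t ht Y => ?_
  rw [evalEval_sub, evalEval_mul, evalEval_mul, evalEval_dehomogenize (hP.pderiv 0) ht,
    evalEval_dehomogenize (hP.pderiv 1) ht, evalEval_dehomogenize (hQ.pderiv 0) ht,
    evalEval_dehomogenize (hQ.pderiv 1) ht, evalEval_C, eval_mul, eval_C, eval_pow, eval_X]
  have := congrArg (MvPolynomial.eval ![t⁻¹, t⁻¹ * Y]) hJ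
  rw [jacobian, map_sub, map_mul, map_mul, MvPolynomial.eval_C] at this
  rw [← this, pow_add]
  ring

theorem eulerDeriv_map_expand (m : ℕ) (F : ℂ[X][X]) :
    eulerDeriv (F.map (expand ℂ m).toRingHom) =
      (m : ℂ[X][X]) * (eulerDeriv F).map (expand ℂ m).toRingHom := by
  ext1 i
  rw [coeff_eulerDeriv, coeff_map, ← C_eq_natCast, coeff_C_mul, coeff_map, coeff_eulerDeriv]
  simp only [AlgHom.toRingHom_eq_coe, RingHom.coe_coe, derivative_expand, map_mul, expand_X]
  rcases m with _ | m
  · simp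
  · simp only [Nat.add_sub_cancel, pow_succ]
    ring

theorem weightedWronskian_map_expand (m : ℕ) (N N' : ℂ) (G H : ℂ[X][X]) :
    weightedWronskian (m * N) (m * N') (G.map (expand ℂ m).toRingHom)
      (H.map (expand ℂ m).toRingHom) =
    (m : ℂ[X][X]) * (weightedWronskian N N' G H).map (expand ℂ m).toRingHom := by
  simp only [weightedWronskian, eulerDeriv_map_expand, Polynomial.map_sub, Polynomial.map_mul,
    derivative_map, map_C]
  simp
  ring

/-- The terms from differentiating the substitution in `t` are the same multiple of both
`Y`-derivatives and cancel; only the factor `∂Y/∂ξ = t ^ k` remains. -/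
theorem weightedWronskian_comp (N N' : ℂ) (G H : ℂ[X][X]) (w : ℂ[X]) (k : ℕ) :
    weightedWronskian N N' (G.comp (C (X ^ k) * X + C w)) (H.comp (C (X ^ k) * X + C w)) =
      C (X ^ k) * (weightedWronskian N N' G H).comp (C (X ^ k) * X + C w) := by
  simp only [weightedWronskian, eulerDeriv_comp, derivative_comp, sub_comp, mul_comp, C_comp]
  simp only [derivative_add, derivative_C_mul, derivative_X, derivative_C]
  ring

theorem weightedWronskian_C_X_pow_mul (N N' : ℂ) (a b : ℕ) (g h : ℂ[X][X]) :
    weightedWronskian N N' (C (X ^ a) * g) (C (X ^ b) * h) =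
      C (X ^ (a + b)) * weightedWronskian (N - a) (N' - b) g h := by
  simp only [weightedWronskian, Derivation.leibniz, eulerDeriv_C_X_pow, derivative_C_mul, pow_add,
    C_mul, C_sub, smul_eq_mul]
  simp
  ring

theorem map_eval_zero_eulerDeriv (g : ℂ[X][X]) : (eulerDeriv g).map (evalRingHom 0) = 0 := by
  ext i
  rw [coeff_map, coeff_eulerDeriv]
  simp

/-- If the weighted Wronskian does not depend on `Y`, neither does the one of the lowest order
terms. -/
theorem exists_wronskian_eq_C {N N' : ℂ} {a b : ℕ} {g h : ℂ[X][X]} {r : ℂ[X]}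
    (hr : weightedWronskian N N' (C (X ^ a) * g) (C (X ^ b) * h) = C r) :
    ∃ c : ℂ, C (N - a) * g.map (evalRingHom 0) * derivative (h.map (evalRingHom 0)) -
      C (N' - b) * h.map (evalRingHom 0) * derivative (g.map (evalRingHom 0)) = C c := by
  rw [weightedWronskian_C_X_pow_mul] at hr
  set W := weightedWronskian (N - a) (N' - b) g h with hW
  have hWC : W = C (W.coeff 0) := by
    ext1 i
    rw [coeff_C]
    split_ifs with hi
    · rw [hi]
    · have := congrArg (fun f => f.coeff i) hr
      rw [coeff_C_mul, coeff_C, if_neg hi] at this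
      exact (mul_eq_zero.1 this).resolve_left (pow_ne_zero _ X_ne_zero)
  refine ⟨-(W.coeff 0).eval 0, ?_⟩
  -- At `t = 0` the Euler derivatives vanish and only the weights survive.
  have h1 := congrArg (map (evalRingHom 0)) hWC
  conv_lhs at h1 => rw [hW, weightedWronskian]
  simp only [Polynomial.map_sub, Polynomial.map_mul, map_eval_zero_eulerDeriv, map_C,
    coe_evalRingHom, eval_C, ← derivative_map] at h1
  rw [C_neg, ← h1]
  ring

theorem coeff_single_of_isMonicInY {P : Poly} {n : ℕ} {A : ℂ} (h : IsMonicInY P n A) :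
    P.coeff (Finsupp.single 1 n) = A := by
  obtain ⟨_, a, ha⟩ := h
  rw [ha, MvPolynomial.coeff_add, MvPolynomial.coeff_C_mul, MvPolynomial.coeff_X_pow,
    if_pos rfl, mul_one, MvPolynomial.coeff_sum, Finset.sum_eq_zero, add_zero]
  intro i _
  rw [aeval_eq_sum_range, Finset.sum_mul, MvPolynomial.coeff_sum, Finset.sum_eq_zero]
  intro j _
  rw [smul_mul_assoc, MvPolynomial.coeff_smul, MvPolynomial.X_pow_eq_monomial,
    MvPolynomial.X_pow_eq_monomial, MvPolynomial.monomial_mul, MvPolynomial.coeff_monomial, if_neg,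
    smul_zero]
  intro h
  have := DFunLike.congr_fun h 1
  have hi := i.2
  simp at this
  omega

theorem coeff_dehomogenize {P : Poly} {n : ℕ} (hP : DegreeLE P n) :
    (dehomogenize n P).coeff n = C (P.coeff (Finsupp.single 1 n)) := by
  rw [dehomogenize_eq_sum, finsetSum_coeff, Finset.sum_eq_single (Finsupp.single 1 n)]
  · simp [coeff_X_pow]
  · intro s hs hne
    rw [coeff_C_mul_X_pow, if_neg]
    intro h1
    have hs' := hP s (MvPolynomial.mem_support_iff.1 hs)
    apply hne
    ext i
    fin_cases i
    · simp; omega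
    · simp [h1]
  · intro h
    rw [MvPolynomial.notMem_support_iff.1 h]
    simp

theorem natDegree_dehomogenize_le {P : Poly} {n : ℕ} (hP : DegreeLE P n) :
    (dehomogenize n P).natDegree ≤ n := by
  rw [dehomogenize_eq_sum]
  refine natDegree_sum_le_of_forall_le _ _ fun s hs => ?_
  have hs' := hP s (MvPolynomial.mem_support_iff.1 hs)
  exact (natDegree_C_mul_X_pow_le _ _).trans (by omega)

end PlanePoly

/-! ### Approximate roots of the pair and the polynomials found at a center. -/

namespace PlanePoly

open Polynomial NewtonChain

/-- `G` is congruent modulo `t ^ N` to `A * ∏ i, (Y - u i)`. -/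
def HasApproxRoots {ι : Type*} [Fintype ι] (G : ℂ[X][X]) (A : ℂ) (u : ι → ℂ[X]) (N : ℕ) : Prop :=
  ∃ E : ℂ[X][X], G = C (C A) * ∏ i, (X - C (u i)) + C (X ^ N) * E

theorem exists_approxRoots {P : Poly} {n : ℕ} {A : ℂ} (hP : DegreeLE P n)
    (hA : IsMonicInY P n A) :
    ∃ s : ℕ, s ≠ 0 ∧ ∀ r ≠ 0, ∀ N : ℕ, ∃ u : Fin n → ℂ[X],
      HasApproxRoots ((dehomogenize n P).map (expand ℂ (s * r)).toRingHom) A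
        (fun i => expand ℂ r (u i)) N := by
  have hA0 : A ≠ 0 := hA.1
  have hc : (dehomogenize n P).coeff n = C A := by
    rw [coeff_dehomogenize hP, coeff_single_of_isMonicInY hA]
  set F := C (C A⁻¹) * dehomogenize n P with hF
  have hle : F.natDegree ≤ n := (natDegree_C_mul_le _ _).trans (natDegree_dehomogenize_le hP)
  have hFc : F.coeff n = 1 := by
    rw [hF, coeff_C_mul, hc, ← C_mul, inv_mul_cancel₀ hA0, C_1]
  have hFm : F.Monic := monic_of_natDegree_le_of_coeff_eq_one n hle hFc
  have hFd : F.natDegree = n := natDegree_eq_of_le_of_coeff_ne_zero hle (by rw [hFc]; simp)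
  have hG : dehomogenize n P = C (C A) * F := by
    rw [hF, ← mul_assoc, ← C_mul, ← C_mul, mul_inv_cancel₀ hA0, C_1, C_1, one_mul]
  obtain ⟨s, hs, h⟩ := Puiseux.exists_prod_expand_add F hFm
  rw [hFd] at h
  refine ⟨s, hs, fun r hr N => ?_⟩
  obtain ⟨u, E, hE⟩ := h r hr N
  refine ⟨u, C (C A) * E, ?_⟩
  rw [hG, Polynomial.map_mul, hE, map_C]
  simp
  ring

/-- One ramification `m` serves both polynomials. The additional factor `n!` is there for
`totalOrder_hits`; it is needed for `P` alone, since the order of `Q` follows by proportionality. -/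
theorem exists_common_approxRoots {P Q : Poly} {n n' : ℕ} {A B : ℂ} (hP : DegreeLE P n)
    (hQ : DegreeLE Q n') (hA : IsMonicInY P n A) (hB : IsMonicInY Q n' B) :
    ∃ m S : ℕ, m ≠ 0 ∧ S ∣ m ∧ n.factorial ∣ S ∧ S ≠ 0 ∧ ∀ N : ℕ,
      ∃ (u : Fin n → ℂ[X]) (u' : Fin n' → ℂ[X]),
      HasApproxRoots ((dehomogenize n P).map (expand ℂ m).toRingHom) A
        (fun i => expand ℂ S (u i)) N ∧
      HasApproxRoots ((dehomogenize n' Q).map (expand ℂ m).toRingHom) B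
        (fun i => expand ℂ S (u' i)) N := by
  obtain ⟨s, hs, h⟩ := exists_approxRoots hP hA
  obtain ⟨s', hs', h'⟩ := exists_approxRoots hQ hB
  have hS : n.factorial ≠ 0 := n.factorial_ne_zero
  refine ⟨s * (s' * n.factorial), n.factorial, by positivity, ⟨s * s', by ring⟩, dvd_rfl, hS,
    fun N => ?_⟩
  obtain ⟨u, hu⟩ := h (s' * n.factorial) (by positivity) N
  obtain ⟨u', hu'⟩ := h' (s * n.factorial) (by positivity) N
  refine ⟨fun i => expand ℂ s' (u i), fun i => expand ℂ s (u' i), ?_, ?_⟩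
  · simpa only [← expand_mul, mul_comm n.factorial s'] using hu
  · rw [show s * (s' * n.factorial) = s' * (s * n.factorial) by ring]
    simpa only [← expand_mul, mul_comm n.factorial s] using hu'

theorem dvd_natTrailingDegree_expand {S : ℕ} (hS : S ≠ 0) {v : ℂ[X]}
    (hv : expand ℂ S v ≠ 0) : S ∣ (expand ℂ S v).natTrailingDegree := by
  by_contra h
  apply trailingCoeff_eq_zero.not.2 hv
  rw [trailingCoeff, coeff_expand (Nat.pos_of_ne_zero hS), if_neg h]

/-- An error of order `N` cannot affect a lowest coefficient of order below `N`. -/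
theorem HasApproxRoots.exists_lift {ι : Type*} [Fintype ι] {G : ℂ[X][X]} {A : ℂ} {u : ι → ℂ[X]}
    {N : ℕ} (h : HasApproxRoots G A u N) (w : ℂ[X]) (k : ℕ)
    (hN : totalOrder (fun i => w - u i) k < N) :
    ∃ g : ℂ[X][X], G.comp (C (X ^ k) * X + C w) =
        C (X ^ totalOrder (fun i => w - u i) k) * g ∧
      g.map (evalRingHom 0) = residuePoly A (fun i => w - u i) k := by
  obtain ⟨E, hE⟩ := h
  obtain ⟨g, hg, hg0⟩ := exists_lift_residuePoly (fun i => w - u i) A k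
  set α := totalOrder (fun i => w - u i) k
  refine ⟨g + C (X ^ (N - α)) * E.comp (C (X ^ k) * X + C w), ?_, ?_⟩
  · rw [mul_add, ← hg, ← mul_assoc, ← C_mul, ← pow_add, Nat.add_sub_cancel' hN.le, hE, add_comp,
      mul_comp, mul_comp, C_comp, C_comp, prod_comp]
    congr 2
    refine Finset.prod_congr rfl fun i _ => ?_
    simp only [sub_comp, X_comp, C_comp, C_sub]
    ring
  · rw [Polynomial.map_add, hg0, Polynomial.map_mul, map_C]
    have : N - α ≠ 0 := by omega
    simp [this]

/-- A polynomial center `w` at which both orders reach the required values gives a pair of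
polynomials of proportional degrees. -/
theorem exists_dicritical_at_center {P Q : Poly} {K d e m S N : ℕ} {A B c : ℂ}
    (hP : DegreeLE P (d * K)) (hQ : DegreeLE Q (e * K)) (hJ : jacobian P Q = MvPolynomial.C c)
    (hde : Nat.Coprime d e) (hd : 0 < d) (he : 0 < e) (hK : 0 < K) (hm : m ≠ 0)
    (hA : A ≠ 0) (hB : B ≠ 0) (hS : S ≠ 0) (hSm : S ∣ m) (hnS : (d * K).factorial ∣ S)
    {u : Fin (d * K) → ℂ[X]} {u' : Fin (e * K) → ℂ[X]}
    (hu : HasApproxRoots ((dehomogenize (d * K) P).map (expand ℂ m).toRingHom) A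
        (fun i => expand ℂ S (u i)) N)
    (hu' : HasApproxRoots ((dehomogenize (e * K) Q).map (expand ℂ m).toRingHom) B
        (fun i => expand ℂ S (u' i)) N)
    (hN : d * (m * K) < N) (hN' : e * (m * K) < N) (w : ℂ[X])
    (hα : ∃ k, d * (m * K) ≤ totalOrder (fun i => expand ℂ S w - expand ℂ S (u i)) k)
    (hβ : ∃ k, e * (m * K) ≤ totalOrder (fun i => expand ℂ S w - expand ℂ S (u' i)) k) :
    ∃ k M : ℕ, ∃ p q : ℂ[X], 1 ≤ M ∧
      p = residuePoly A (fun i => expand ℂ S w - expand ℂ S (u i)) k ∧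
      totalOrder (fun i => expand ℂ S w - expand ℂ S (u i)) k = d * (m * K) ∧
      p.natDegree = d * M ∧ q.natDegree = e * M ∧
      B ^ d * p.leadingCoeff ^ e = A ^ e * q.leadingCoeff ^ d ∧
      (∃ g : ℂ[X][X], ((dehomogenize (d * K) P).map (expand ℂ m).toRingHom).comp
        (C (X ^ k) * X + C (expand ℂ S w)) = C (X ^ (d * (m * K))) * g ∧
        g.map (evalRingHom 0) = p) ∧
      (∃ h : ℂ[X][X], ((dehomogenize (e * K) Q).map (expand ℂ m).toRingHom).comp
        (C (X ^ k) * X + C (expand ℂ S w)) = C (X ^ (e * (m * K))) * h ∧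
        h.map (evalRingHom 0) = q) := by
  set v : Fin (d * K) → ℂ[X] := fun i => expand ℂ S w - expand ℂ S (u i) with hv
  set v' : Fin (e * K) → ℂ[X] := fun i => expand ℂ S w - expand ℂ S (u' i) with hv'
  have hp := isChain_residuePoly hA v
  have hq := isChain_residuePoly hB v'
  rw [Fintype.card_fin] at hp hq
  have hW : ∀ k, totalOrder v k < d * (m * K) → totalOrder v' k < e * (m * K) → ∃ c : ℂ,
      C ((d * (m * K : ℕ) : ℂ) - totalOrder v k) * residuePoly A v k *
          derivative (residuePoly B v' k) -
        C ((e * (m * K : ℕ) : ℂ) - totalOrder v' k) * residuePoly B v' k *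
          derivative (residuePoly A v k) = C c := by
    intro k h1 h2
    obtain ⟨g, hg, hg0⟩ := hu.exists_lift (expand ℂ S w) k (h1.trans hN)
    obtain ⟨h, hh, hh0⟩ := hu'.exists_lift (expand ℂ S w) k (h2.trans hN')
    -- The Wronskian is a function of `t` alone, and remains so after ramification and zooming.
    have hWG := weightedWronskian_dehomogenize hP hQ hJ
    have hWm := weightedWronskian_map_expand m ((d * K : ℕ) : ℂ) ((e * K : ℕ) : ℂ)
      (dehomogenize (d * K) P) (dehomogenize (e * K) Q)
    have hWc := weightedWronskian_comp (m * ((d * K : ℕ) : ℂ)) (m * ((e * K : ℕ) : ℂ))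
      ((dehomogenize (d * K) P).map (expand ℂ m).toRingHom)
      ((dehomogenize (e * K) Q).map (expand ℂ m).toRingHom) (expand ℂ S w) k
    rw [hWm, hWG, hg, hh, map_C, mul_comp, C_comp, ← C_eq_natCast, C_comp, ← C_mul, ← C_mul] at hWc
    have := exists_wronskian_eq_C hWc
    rw [hg0, hh0] at this
    convert this using 8 <;> push_cast <;> ring
  obtain ⟨k, M, hM, h1, h2, h3, h4, h5⟩ := exists_dicritical (K := K) (L := m * K) hde hd he
    (by positivity) hp hq hW hα hβ fun k hk hk' =>
      totalOrder_hits (S := S) v (fun i hi => by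
          have : v i = expand ℂ S (w - u i) := by rw [hv, map_sub]
          rw [this] at hi ⊢
          exact dvd_natTrailingDegree_expand hS hi)
        (by rwa [Fintype.card_fin])
        ((hSm.trans (dvd_mul_right m K)).trans (dvd_mul_left _ d)) hk hk'
  refine ⟨k, M, _, residuePoly B v' k, hM, rfl, h1, h3, h4, h5, ?_, ?_⟩
  · have := hu.exists_lift (expand ℂ S w) k (by rw [← hv, h1]; exact hN)
    rwa [← hv, h1] at this
  · have := hu'.exists_lift (expand ℂ S w) k (by rw [← hv', h2]; exact hN')
    rwa [← hv', h2] at this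

end PlanePoly

/-! ### Growth estimates and ultrafilters escaping to infinity. -/

namespace PlanePoly

open Polynomial NewtonChain Filter

theorem evalEval_eq_eval_map (F : ℂ[X][X]) (t Y : ℂ) :
    F.evalEval t Y = (F.map (evalRingHom t)).eval Y := (map_evalRingHom_eval t Y F).symm

theorem evalEval_comp (F q : ℂ[X][X]) (t Y : ℂ) :
    (F.comp q).evalEval t Y = F.evalEval t (q.evalEval t Y) := by
  rw [evalEval_eq_eval_map, Polynomial.map_comp, eval_comp, evalEval_eq_eval_map,
    evalEval_eq_eval_map]

theorem evalEval_eq_sum (F : ℂ[X][X]) (t Y : ℂ) {n : ℕ} (hn : F.natDegree ≤ n) :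
    F.evalEval t Y = ∑ i ∈ Finset.range (n + 1), (F.coeff i).eval t * Y ^ i := by
  rw [evalEval_eq_eval_map, eval_eq_sum_range' (n := n + 1)
    (Nat.lt_succ_of_le ((natDegree_map_le).trans hn))]
  simp

theorem continuous_evalEval (F : ℂ[X][X]) : Continuous fun z : ℂ × ℂ => F.evalEval z.1 z.2 := by
  simp only [fun z : ℂ × ℂ => evalEval_eq_sum F z.1 z.2 le_rfl]
  fun_prop

theorem evalEval_map_expand (m : ℕ) (F : ℂ[X][X]) (t Y : ℂ) :
    (F.map (expand ℂ m).toRingHom).evalEval t Y = F.evalEval (t ^ m) Y := by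
  rw [evalEval_eq_sum _ _ _ natDegree_map_le, evalEval_eq_sum F _ _ le_rfl]
  simp [expand_eval]

theorem evalEval_map_expand_dehomogenize {P : Poly} {n : ℕ} (hP : DegreeLE P n) (m : ℕ) {t : ℂ}
    (ht : t ≠ 0) (Y : ℂ) :
    ((dehomogenize n P).map (expand ℂ m).toRingHom).evalEval t Y =
      t ^ (m * n) * MvPolynomial.eval ![(t ^ m)⁻¹, (t ^ m)⁻¹ * Y] P := by
  rw [evalEval_map_expand, evalEval_dehomogenize hP (pow_ne_zero _ ht), pow_mul]

/-- At the target order the powers of `t` cancel exactly, so `P` along the branch extends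
polynomially to `t = 0`. -/
theorem eval_eq_evalEval_of_comp_eq {P : Poly} {n m k : ℕ} (hP : DegreeLE P n) {w : ℂ[X]}
    {g : ℂ[X][X]}
    (hg : ((dehomogenize n P).map (expand ℂ m).toRingHom).comp (C (X ^ k) * X + C w) =
      C (X ^ (m * n)) * g) {t : ℂ} (ht : t ≠ 0) (ξ : ℂ) :
    MvPolynomial.eval ![(t ^ m)⁻¹, (t ^ m)⁻¹ * (t ^ k * ξ + w.eval t)] P = g.evalEval t ξ := by
  have h := congrArg (evalEval t ξ) hg
  rw [evalEval_comp, evalEval_mul, evalEval_C, evalEval_add, evalEval_mul, evalEval_C, evalEval_C,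
    evalEval_X, evalEval_map_expand_dehomogenize hP m ht, eval_pow, eval_pow, eval_X] at h
  exact mul_left_cancel₀ (pow_ne_zero _ ht) h

theorem exists_norm_evalEval_le (F : ℂ[X][X]) (R R' : ℝ) :
    ∃ M : ℝ, ∀ t Y : ℂ, ‖t‖ ≤ R → ‖Y‖ ≤ R' → ‖F.evalEval t Y‖ ≤ M := by
  obtain ⟨M, hM⟩ := ((isCompact_closedBall (0 : ℂ) R).prod
    (isCompact_closedBall (0 : ℂ) R')).exists_bound_of_continuousOn
      (continuous_evalEval F).continuousOn
  exact ⟨M, fun t Y ht hY => hM (t, Y) ⟨by simpa using ht, by simpa using hY⟩⟩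

theorem exists_norm_eval_le (p : ℂ[X]) (R : ℝ) :
    ∃ M : ℝ, 0 ≤ M ∧ ∀ t : ℂ, ‖t‖ ≤ R → ‖p.eval t‖ ≤ M := by
  obtain ⟨M, hM⟩ := (isCompact_closedBall (0 : ℂ) R).exists_bound_of_continuousOn
    p.continuous.continuousOn
  exact ⟨max M 0, le_max_right _ _, fun t ht => (hM t (by simpa using ht)).trans (le_max_left _ _)⟩

/-- Roots of monic polynomials are bounded in terms of bounds for the coefficients. -/
theorem exists_norm_le_of_norm_evalEval_le {F : ℂ[X][X]} {n : ℕ} {A : ℂ} (hn : n ≠ 0)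
    (hF : F.natDegree ≤ n) (hFc : F.coeff n = C A) (hA : A ≠ 0) (R M : ℝ) :
    ∃ R' : ℝ, ∀ t Y : ℂ, ‖t‖ ≤ R → ‖F.evalEval t Y‖ ≤ M → ‖Y‖ ≤ R' := by
  choose b hb0 hb using fun i => exists_norm_eval_le (F.coeff i) R
  have hA' : 0 < ‖A‖ := norm_pos_iff.2 hA
  refine ⟨max 1 ((M + ∑ i ∈ Finset.range n, b i) / ‖A‖), fun t Y ht hM => ?_⟩
  by_contra hY
  rw [not_le, max_lt_iff, div_lt_iff₀ hA'] at hY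
  obtain ⟨hY1, hY2⟩ := hY
  obtain ⟨n, rfl⟩ := Nat.exists_eq_succ_of_ne_zero hn
  have hpow : 0 < ‖Y‖ ^ n := by positivity
  have h1 : A * Y ^ (n + 1) = F.evalEval t Y -
      ∑ i ∈ Finset.range (n + 1), (F.coeff i).eval t * Y ^ i := by
    rw [evalEval_eq_sum F t Y hF, Finset.sum_range_succ _ (n + 1), hFc]
    simp
  have h2 : ‖A‖ * ‖Y‖ ^ (n + 1) ≤ M + ∑ i ∈ Finset.range (n + 1), b i * ‖Y‖ ^ n := by
    rw [← norm_pow, ← norm_mul, h1]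
    refine (norm_sub_le _ _).trans (add_le_add hM ((norm_sum_le _ _).trans ?_))
    refine Finset.sum_le_sum fun i hi => ?_
    rw [norm_mul, norm_pow]
    exact mul_le_mul (hb i t ht)
      (pow_le_pow_right₀ hY1.le (Nat.lt_succ_iff.1 (Finset.mem_range.1 hi))) (by positivity)
      (hb0 i)
  have hM0 : 0 ≤ M := (norm_nonneg _).trans hM
  have h3 : M ≤ M * ‖Y‖ ^ n := le_mul_of_one_le_right hM0 (one_le_pow₀ hY1.le)
  rw [← Finset.sum_mul] at h2
  have h4 : ‖Y‖ * ‖A‖ * ‖Y‖ ^ n ≤ (M + ∑ i ∈ Finset.range (n + 1), b i) * ‖Y‖ ^ n := by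
    calc ‖Y‖ * ‖A‖ * ‖Y‖ ^ n = ‖A‖ * ‖Y‖ ^ (n + 1) := by ring
      _ ≤ _ := h2
      _ ≤ _ := by rw [add_mul]; exact add_le_add_left h3 _
  exact absurd (le_of_mul_le_mul_right h4 hpow) (not_le.2 hY2)

theorem exists_bivariate_of_isMonicInY {P : Poly} {n : ℕ} {A : ℂ} (h : IsMonicInY P n A) :
    ∃ F : ℂ[X][X], F.natDegree ≤ n ∧ F.coeff n = C A ∧
      ∀ z : Plane, MvPolynomial.eval z P = F.evalEval (z 0) (z 1) := by
  obtain ⟨_, a, ha⟩ := h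
  refine ⟨C (C A) * X ^ n + ∑ i : Fin n, C (a i) * X ^ (i : ℕ), ?_, ?_, fun z => ?_⟩
  · refine natDegree_add_le_of_degree_le (natDegree_C_mul_X_pow_le _ _)
      (natDegree_sum_le_of_forall_le _ _ fun i _ => ?_)
    exact (natDegree_C_mul_X_pow_le _ _).trans i.2.le
  · rw [coeff_add, coeff_C_mul_X_pow, if_pos rfl, finsetSum_coeff, Finset.sum_eq_zero, add_zero]
    intro i _
    rw [coeff_C_mul_X_pow, if_neg i.2.ne']
  · have haeval : ∀ p : ℂ[X], MvPolynomial.eval z (aeval (MvPolynomial.X 0 : Poly) p) =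
        p.eval (z 0) := by
      intro p
      induction p using Polynomial.induction_on' with
      | add p q hp hq => simp [hp, hq]
      | monomial n c => simp [aeval_monomial, MvPolynomial.algebraMap_eq]
    rw [ha]
    simp [evalEval_finsetSum, haeval, evalEval_C]

theorem continuous_polyMap (P Q : Poly) : Continuous (polyMap P Q) := by
  refine continuous_pi fun i => ?_
  fin_cases i
  · exact MvPolynomial.continuous_eval P
  · exact MvPolynomial.continuous_eval Q

theorem mem_nonProperValueSet_of_tendsto {f : Plane → Plane} {γ : Type*} {l : Filter γ} [l.NeBot]
    {z : γ → Plane} {a : Plane} (hz : Tendsto (fun s => ‖z s‖) l atTop)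
    (hf : Tendsto (fun s => f (z s)) l (𝓝 a)) : a ∈ nonProperValueSet f := by
  intro K hK _ hcomp
  obtain ⟨R, hR⟩ := hcomp.isBounded.exists_norm_le
  obtain ⟨s, hs1, hs2⟩ := ((hf.eventually hK).and (hz.eventually_gt_atTop R)).exists
  exact absurd (hR _ hs1) (not_le.2 hs2)

/-- Otherwise the preimage of some closed ball around `a` would be closed and bounded. An
ultrafilter spares passing to subsequences when a nearest root and a limit of `ξ` are chosen later.
-/
theorem exists_ultrafilter_of_mem_nonProperValueSet {f : Plane → Plane} (hf : Continuous f)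
    {a : Plane} (ha : a ∈ nonProperValueSet f) :
    ∃ l : Ultrafilter Plane, Tendsto (fun z : Plane => ‖z‖) (l : Filter Plane) atTop ∧
      Tendsto f (l : Filter Plane) (𝓝 a) := by
  have hne : (comap (fun z : Plane => ‖z‖) atTop ⊓ comap f (𝓝 a)).NeBot := by
    rw [inf_neBot_iff]
    intro s hs s' hs'
    obtain ⟨s₁, hs₁, hs₁'⟩ := hs
    obtain ⟨R, hR⟩ := mem_atTop_sets.1 hs₁
    obtain ⟨s₂, hs₂, hs₂'⟩ := hs'
    obtain ⟨ε, hε, hεs⟩ := Metric.nhds_basis_closedBall.mem_iff.1 hs₂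
    by_contra hempty
    refine ha (Metric.closedBall a ε) (Metric.closedBall_mem_nhds a hε)
      (isCompact_closedBall a ε) ?_
    refine (isCompact_closedBall (0 : Plane) R).of_isClosed_subset
      (Metric.isClosed_closedBall.preimage hf) fun z hz => ?_
    rw [mem_closedBall_zero_iff]
    by_contra hzR
    exact hempty ⟨z, hs₁' (hR _ (not_le.1 hzR).le), hs₂' (hεs hz)⟩
  obtain ⟨l, hl⟩ := Ultrafilter.exists_le (comap (fun z : Plane => ‖z‖) atTop ⊓ comap f (𝓝 a))
  exact ⟨l, tendsto_comap.mono_left (hl.trans inf_le_left),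
    tendsto_comap.mono_left (hl.trans inf_le_right)⟩

theorem exists_norm_eval_ge {v : ℂ[X]} (hv : v ≠ 0) :
    ∃ c : ℝ, 0 < c ∧ ∀ᶠ t in 𝓝 (0 : ℂ), c * ‖t‖ ^ v.natTrailingDegree ≤ ‖v.eval t‖ := by
  obtain ⟨b, hb⟩ := X_pow_natTrailingDegree_dvd v
  have hb0 : b.eval 0 ≠ 0 := by
    have h1 : v.trailingCoeff ≠ 0 := trailingCoeff_eq_zero.not.2 hv
    rw [trailingCoeff] at h1
    generalize v.natTrailingDegree = n at hb h1
    rw [hb] at h1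
    rw [← coeff_zero_eq_eval_zero]
    simpa [coeff_X_pow_mul'] using h1
  have hpos : 0 < ‖b.eval 0‖ := norm_pos_iff.2 hb0
  refine ⟨‖b.eval 0‖ / 2, by positivity, ?_⟩
  have hcont : Tendsto (fun t => ‖b.eval t‖) (𝓝 0) (𝓝 ‖b.eval 0‖) :=
    (b.continuous.norm.tendsto 0)
  filter_upwards [hcont.eventually (lt_mem_nhds (half_lt_self hpos))] with t ht
  have : ‖v.eval t‖ = ‖t‖ ^ v.natTrailingDegree * ‖b.eval t‖ := by
    conv_lhs => rw [hb]
    rw [eval_mul, eval_pow, eval_X, norm_mul, norm_pow]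
  rw [this, mul_comm]
  exact mul_le_mul_of_nonneg_left ht.le (by positivity)

/-- If `w` is at least as close to `Y` as `u`, then `Y - u` is not small. -/
theorem exists_norm_sub_ge (w u : ℂ[X]) (k : ℕ) :
    ∃ c : ℝ, 0 < c ∧ ∀ᶠ t in 𝓝 (0 : ℂ), ∀ ξ : ℂ,
      ‖t ^ k * ξ‖ ≤ ‖t ^ k * ξ + w.eval t - u.eval t‖ →
      c * (‖t‖ ^ truncOrder k (w - u) * ‖ξ‖ ^ (residueFactor k (w - u)).natDegree) ≤
        ‖t ^ k * ξ + w.eval t - u.eval t‖ := by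
  by_cases h : X ^ k ∣ w - u
  · refine ⟨1, one_pos, Eventually.of_forall fun t ξ hξ => ?_⟩
    rw [residueFactor_of_dvd h, truncOrder_of_dvd h, natDegree_X_add_C, one_mul, pow_one]
    rwa [norm_mul, norm_pow] at hξ
  · obtain ⟨c, hc, hev⟩ := exists_norm_eval_ge (ne_zero_of_not_dvd h)
    refine ⟨c / 2, by positivity, ?_⟩
    filter_upwards [hev] with t ht ξ hξ
    rw [residueFactor_of_not_dvd h, truncOrder_of_not_dvd h, natDegree_C, pow_zero, mul_one]
    -- Both terms on the right are at most `|Y - u|` in norm, whence `|w - u| ≤ 2 * |Y - u|`.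
    have h1 : (w - u).eval t = (t ^ k * ξ + w.eval t - u.eval t) - t ^ k * ξ := by
      rw [eval_sub]; ring
    have h2 := norm_sub_le (t ^ k * ξ + w.eval t - u.eval t) (t ^ k * ξ)
    rw [← h1] at h2
    linarith

theorem exists_prod_norm_sub_ge {ι : Type*} [Fintype ι] {A : ℂ} (hA : A ≠ 0) (w : ℂ[X])
    (u : ι → ℂ[X]) (k : ℕ) :
    ∃ c : ℝ, 0 < c ∧ ∀ᶠ t in 𝓝 (0 : ℂ), ∀ ξ : ℂ,
      (∀ i, ‖t ^ k * ξ‖ ≤ ‖t ^ k * ξ + w.eval t - (u i).eval t‖) →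
      c * (‖t‖ ^ totalOrder (fun i => w - u i) k *
        ‖ξ‖ ^ (residuePoly A (fun i => w - u i) k).natDegree) ≤
          ∏ i, ‖t ^ k * ξ + w.eval t - (u i).eval t‖ := by
  choose c hc hev using fun i => exists_norm_sub_ge w (u i) k
  refine ⟨∏ i, c i, Finset.prod_pos fun i _ => hc i, ?_⟩
  filter_upwards [eventually_all.2 hev] with t ht ξ hξ
  rw [natDegree_residuePoly _ hA, totalOrder, ← Finset.prod_pow_eq_pow_sum,
    ← Finset.prod_pow_eq_pow_sum, ← Finset.prod_mul_distrib, ← Finset.prod_mul_distrib]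
  refine Finset.prod_le_prod (fun i _ => ?_) fun i _ => ht i ξ (hξ i)
  have := (hc i).le
  positivity

theorem HasApproxRoots.exists_prod_norm_sub_le {ι : Type*} [Fintype ι] {G : ℂ[X][X]} {A : ℂ}
    {u : ι → ℂ[X]} {N D : ℕ} (h : HasApproxRoots G A u N) (hA : A ≠ 0) (hD : D ≤ N) (M R : ℝ) :
    ∃ c : ℝ, ∀ t Y : ℂ, ‖t‖ ≤ 1 → ‖Y‖ ≤ R → ‖G.evalEval t Y‖ ≤ M * ‖t‖ ^ D →
      ∏ i, ‖Y - (u i).eval t‖ ≤ c * ‖t‖ ^ D := by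
  obtain ⟨E, hE⟩ := h
  obtain ⟨M', hM'⟩ := exists_norm_evalEval_le E 1 R
  refine ⟨(M + M') / ‖A‖, fun t Y ht hY hG => ?_⟩
  have hA' : 0 < ‖A‖ := norm_pos_iff.2 hA
  have h1 : A * ∏ i, (Y - (u i).eval t) = G.evalEval t Y - t ^ N * E.evalEval t Y := by
    rw [hE, evalEval_add, evalEval_mul, evalEval_mul, evalEval_prod]
    simp [evalEval_C]
  have h2 : ‖A‖ * ∏ i, ‖Y - (u i).eval t‖ ≤ M * ‖t‖ ^ D + ‖t‖ ^ D * M' := by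
    rw [← norm_prod, ← norm_mul, h1]
    refine (norm_sub_le _ _).trans (add_le_add hG ?_)
    rw [norm_mul, norm_pow]
    exact mul_le_mul (pow_le_pow_of_le_one (norm_nonneg _) ht hD) (hM' t Y ht hY) (norm_nonneg _)
      (by positivity)
  rw [div_mul_eq_mul_div, le_div_iff₀ hA']
  linarith

end PlanePoly

/-! ### Branches at infinity and the curves they sweep out. -/

namespace PlanePoly

open Polynomial NewtonChain Filter

/-- Near a non-proper value, the points escape to infinity along `x = t ^ (-m)`,
`y = t ^ (-m) * Y` with `t → 0` and `Y` bounded. -/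
theorem exists_branch {P Q : Poly} {n m : ℕ} {A : ℂ} (hn : n ≠ 0) (hm : m ≠ 0)
    (hP : DegreeLE P n) (hA : IsMonicInY P n A) {a : Plane}
    (ha : a ∈ nonProperValueSet (polyMap P Q)) :
    ∃ (l : Ultrafilter Plane) (t Y : Plane → ℂ) (R : ℝ),
      Tendsto (polyMap P Q) (l : Filter Plane) (𝓝 a) ∧ Tendsto t (l : Filter Plane) (𝓝 0) ∧
      (∀ᶠ z in (l : Filter Plane), t z ≠ 0) ∧
      (∀ᶠ z in (l : Filter Plane), z = ![(t z ^ m)⁻¹, (t z ^ m)⁻¹ * Y z]) ∧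
      ∀ᶠ z in (l : Filter Plane), ‖Y z‖ ≤ R := by
  obtain ⟨l, hl, hla⟩ :=
    exists_ultrafilter_of_mem_nonProperValueSet (continuous_polyMap P Q) ha
  have hPb : ∀ᶠ z in (l : Filter Plane), ‖MvPolynomial.eval z P‖ ≤ ‖a 0‖ + 1 := by
    have h1 : Tendsto (fun z => ‖polyMap P Q z 0‖) (l : Filter Plane) (𝓝 ‖a 0‖) :=
      ((continuous_apply 0).tendsto a |>.comp hla).norm
    exact (h1.eventually (gt_mem_nhds (lt_add_one _))).mono fun z hz => hz.le
  -- If `x` stayed bounded, the bound on `P`, monic in `y`, would bound `y` too.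
  have hx : Tendsto (fun z : Plane => ‖z 0‖) (l : Filter Plane) atTop := by
    rw [tendsto_atTop]
    intro R
    by_contra hcon
    rw [← Ultrafilter.eventually_not] at hcon
    obtain ⟨F, hF, hFc, hFe⟩ := exists_bivariate_of_isMonicInY hA
    obtain ⟨R', hR'⟩ := exists_norm_le_of_norm_evalEval_le hn hF hFc hA.1 R (‖a 0‖ + 1)
    obtain ⟨z, hz1, hz2, hz3⟩ :=
      (hcon.and (hPb.and (hl.eventually_gt_atTop (max (max R R') 0)))).exists
    rw [hFe] at hz2
    have h1 := hR' _ _ (not_le.1 hz1).le hz2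
    refine absurd hz3 (not_lt.2 ?_)
    rw [pi_norm_le_iff_of_nonneg (le_max_right _ _)]
    intro i
    fin_cases i
    · exact (not_le.1 hz1).le.trans ((le_max_left _ _).trans (le_max_left _ _))
    · exact h1.trans ((le_max_right _ _).trans (le_max_left _ _))
  choose t ht using fun z : Plane => IsAlgClosed.exists_pow_nat_eq (z 0)⁻¹ (Nat.pos_of_ne_zero hm)
  have htm : Tendsto (fun z => ‖t z‖ ^ m) (l : Filter Plane) (𝓝 0) := by
    have : (fun z => ‖t z‖ ^ m) = fun z : Plane => ‖z 0‖⁻¹ := by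
      funext z
      rw [← norm_pow, ht, norm_inv]
    rw [this]
    exact tendsto_inv_atTop_zero.comp hx
  have ht0 : Tendsto t (l : Filter Plane) (𝓝 0) := by
    rw [tendsto_zero_iff_norm_tendsto_zero, Metric.tendsto_nhds]
    intro ε hε
    filter_upwards [htm.eventually (gt_mem_nhds (pow_pos hε m))] with z hz
    rw [Real.dist_eq, sub_zero, abs_norm]
    exact lt_of_pow_lt_pow_left₀ m hε.le hz
  have hxne : ∀ᶠ z in (l : Filter Plane), z 0 ≠ 0 :=
    (hx.eventually_gt_atTop 0).mono fun z hz => norm_pos_iff.1 hz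
  have htne : ∀ᶠ z in (l : Filter Plane), t z ≠ 0 := by
    filter_upwards [hxne] with z hz h0
    have := ht z
    rw [h0, zero_pow hm] at this
    exact inv_ne_zero hz this.symm
  have hzeq : ∀ᶠ z in (l : Filter Plane), z = ![(t z ^ m)⁻¹, (t z ^ m)⁻¹ * (t z ^ m * z 1)] := by
    filter_upwards [htne] with z hz
    have hz' := pow_ne_zero m hz
    ext i
    fin_cases i
    · simp [ht]
    · simp [hz]
  set G := (dehomogenize n P).map (expand ℂ m).toRingHom with hG
  have hGd : G.natDegree ≤ n := natDegree_map_le.trans (natDegree_dehomogenize_le hP)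
  have hGc : G.coeff n = C A := by
    rw [hG, coeff_map, coeff_dehomogenize hP, coeff_single_of_isMonicInY hA]
    simp
  obtain ⟨R, hR⟩ := exists_norm_le_of_norm_evalEval_le hn hGd hGc hA.1 1 (‖a 0‖ + 1)
  refine ⟨l, t, fun z => t z ^ m * z 1, R, hla, ht0, htne, hzeq, ?_⟩
  have ht1 : ∀ᶠ z in (l : Filter Plane), ‖t z‖ ≤ 1 := by
    have := (tendsto_zero_iff_norm_tendsto_zero.1 ht0).eventually (gt_mem_nhds one_pos)
    exact this.mono fun z hz => hz.le
  filter_upwards [ht1, htne, hzeq, hPb] with z hz1 hz2 hz3 hz4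
  refine hR (t z) _ hz1 ?_
  rw [hG, evalEval_map_expand_dehomogenize hP m hz2, ← hz3, norm_mul, norm_pow]
  calc ‖t z‖ ^ (m * n) * ‖MvPolynomial.eval z P‖ ≤ 1 * (‖a 0‖ + 1) :=
        mul_le_mul (pow_le_one₀ (norm_nonneg _) hz1) hz4 (norm_nonneg _) zero_le_one
    _ = _ := one_mul _

section Bounds

variable {ι : Type*} [Fintype ι] {G : ℂ[X][X]} {A : ℂ} {u : ι → ℂ[X]} {N D : ℕ}
  {γ : Type*} {l : Filter γ} {t Y : γ → ℂ} {w : ℂ[X]} {M R : ℝ}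

/-- Compares the lower bound for `∏ |Y - u i|` valid near the closest root with the upper bound
coming from the smallness of `G`. -/
theorem HasApproxRoots.exists_eventually_le (hu : HasApproxRoots G A u N) (hA : A ≠ 0)
    (hD : D ≤ N) (ht : Tendsto t l (𝓝 0)) (ht0 : ∀ᶠ s in l, t s ≠ 0)
    (hY : ∀ᶠ s in l, ‖Y s‖ ≤ R) (hG : ∀ᶠ s in l, ‖G.evalEval (t s) (Y s)‖ ≤ M * ‖t s‖ ^ D)
    (hnear : ∀ᶠ s in l, ∀ i, ‖Y s - w.eval (t s)‖ ≤ ‖Y s - (u i).eval (t s)‖) (k : ℕ) :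
    ∃ c : ℝ, ∀ᶠ s in l, ‖t s‖ ^ totalOrder (fun i => w - u i) k *
      ‖(Y s - w.eval (t s)) / t s ^ k‖ ^ (residuePoly A (fun i => w - u i) k).natDegree ≤
        c * ‖t s‖ ^ D := by
  obtain ⟨c, hc, hev⟩ := exists_prod_norm_sub_ge hA w u k
  obtain ⟨c', hc'⟩ := hu.exists_prod_norm_sub_le hA hD M R
  refine ⟨c' / c, ?_⟩
  have ht1 : ∀ᶠ s in l, ‖t s‖ ≤ 1 := by
    have := (tendsto_zero_iff_norm_tendsto_zero.1 ht).eventually (gt_mem_nhds one_pos)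
    exact this.mono fun z hz => hz.le
  filter_upwards [ht.eventually hev, ht1, ht0, hY, hG, hnear] with s h1 h2 h3 h4 h5 h6
  have e1 : t s ^ k * ((Y s - w.eval (t s)) / t s ^ k) = Y s - w.eval (t s) :=
    mul_div_cancel₀ _ (pow_ne_zero _ h3)
  have h7 := h1 ((Y s - w.eval (t s)) / t s ^ k)
  simp only [e1, sub_add_cancel] at h7
  have h8 := (h7 h6).trans (hc' _ _ h2 h4 h5)
  rw [div_mul_eq_mul_div, le_div_iff₀ hc]
  linarith

/-- Zoom to depth `k = D`: an order `α < D` would leave degree zero in `ξ`, and then `|t| ^ α ≤ c *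
|t| ^ D` fails as `t → 0`. -/
theorem HasApproxRoots.le_totalOrder [l.NeBot] (hu : HasApproxRoots G A u N) (hA : A ≠ 0)
    (hD : D ≤ N) (ht : Tendsto t l (𝓝 0)) (ht0 : ∀ᶠ s in l, t s ≠ 0)
    (hY : ∀ᶠ s in l, ‖Y s‖ ≤ R) (hG : ∀ᶠ s in l, ‖G.evalEval (t s) (Y s)‖ ≤ M * ‖t s‖ ^ D)
    (hnear : ∀ᶠ s in l, ∀ i, ‖Y s - w.eval (t s)‖ ≤ ‖Y s - (u i).eval (t s)‖) :
    D ≤ totalOrder (fun i => w - u i) D := by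
  by_contra hlt
  rw [not_le] at hlt
  obtain ⟨c, hc⟩ := hu.exists_eventually_le hA hD ht ht0 hY hG hnear D
  have hdeg : (residuePoly A (fun i => w - u i) D).natDegree = 0 := by
    by_contra h0
    have h1 := mul_natDegree_le_totalOrder (fun i => w - u i) hA D
    have h2 := Nat.le_mul_of_pos_right D (Nat.pos_of_ne_zero h0)
    omega
  set α := totalOrder (fun i => w - u i) D
  have hlim : Tendsto (fun s => c * ‖t s‖ ^ (D - α)) l (𝓝 0) := by
    have h1 := ((tendsto_zero_iff_norm_tendsto_zero.1 ht).pow (D - α)).const_mul c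
    rwa [zero_pow (by omega), mul_zero] at h1
  obtain ⟨s, h1, h2, h3⟩ := (hc.and (ht0.and (hlim.eventually (gt_mem_nhds one_pos)))).exists
  rw [hdeg, pow_zero, mul_one] at h1
  have hpos : 0 < ‖t s‖ ^ α := pow_pos (norm_pos_iff.2 h2) _
  have h4 : ‖t s‖ ^ D = ‖t s‖ ^ (D - α) * ‖t s‖ ^ α := by
    rw [← pow_add, Nat.sub_add_cancel hlt.le]
  rw [h4, ← mul_assoc] at h1
  have := mul_lt_mul_of_pos_right h3 hpos
  linarith

/-- At order exactly `D` the powers of `t` cancel and a positive power of `|ξ|` is bounded. -/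
theorem HasApproxRoots.exists_eventually_norm_le (hu : HasApproxRoots G A u N) (hA : A ≠ 0)
    (hD : D ≤ N) (ht : Tendsto t l (𝓝 0)) (ht0 : ∀ᶠ s in l, t s ≠ 0)
    (hY : ∀ᶠ s in l, ‖Y s‖ ≤ R) (hG : ∀ᶠ s in l, ‖G.evalEval (t s) (Y s)‖ ≤ M * ‖t s‖ ^ D)
    (hnear : ∀ᶠ s in l, ∀ i, ‖Y s - w.eval (t s)‖ ≤ ‖Y s - (u i).eval (t s)‖) {k : ℕ}
    (hk : totalOrder (fun i => w - u i) k = D)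
    (hdeg : (residuePoly A (fun i => w - u i) k).natDegree ≠ 0) :
    ∃ R' : ℝ, ∀ᶠ s in l, ‖(Y s - w.eval (t s)) / t s ^ k‖ ≤ R' := by
  obtain ⟨c, hc⟩ := hu.exists_eventually_le hA hD ht ht0 hY hG hnear k
  refine ⟨max 1 c, ?_⟩
  filter_upwards [hc, ht0] with s h1 h2
  have hpos : 0 < ‖t s‖ ^ D := pow_pos (norm_pos_iff.2 h2) _
  rw [hk, mul_comm] at h1
  have h3 := le_of_mul_le_mul_right h1 hpos
  by_contra h4
  rw [not_le, max_lt_iff] at h4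
  exact absurd ((le_self_pow₀ h4.1.le hdeg).trans h3) (not_le.2 h4.2)

end Bounds

/-- The image of the parametrization `(p, q)`. -/
def curve (p q : ℂ[X]) : Set Plane := Set.range fun ξ : ℂ => (![p.eval ξ, q.eval ξ] : Plane)

section Dicritical

variable {P Q : Poly} {n n' m k : ℕ} {w : ℂ[X]} {g h : ℂ[X][X]}

theorem tendsto_polyMap_of_comp_eq (hP : DegreeLE P n) (hQ : DegreeLE Q n')
    (hg : ((dehomogenize n P).map (expand ℂ m).toRingHom).comp (C (X ^ k) * X + C w) =
      C (X ^ (m * n)) * g)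
    (hh : ((dehomogenize n' Q).map (expand ℂ m).toRingHom).comp (C (X ^ k) * X + C w) =
      C (X ^ (m * n')) * h)
    {γ : Type*} {l : Filter γ} {t ξ : γ → ℂ} {ξ₀ : ℂ} (ht : Tendsto t l (𝓝 0))
    (ht0 : ∀ᶠ s in l, t s ≠ 0) (hξ : Tendsto ξ l (𝓝 ξ₀)) :
    Tendsto (fun s => polyMap P Q ![(t s ^ m)⁻¹, (t s ^ m)⁻¹ *
        (t s ^ k * ξ s + w.eval (t s))]) l
      (𝓝 ![(g.map (evalRingHom 0)).eval ξ₀, (h.map (evalRingHom 0)).eval ξ₀]) := by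
  have hlim : ∀ F : ℂ[X][X], Tendsto (fun s => F.evalEval (t s) (ξ s)) l
      (𝓝 ((F.map (evalRingHom 0)).eval ξ₀)) := by
    intro F
    rw [← evalEval_eq_eval_map]
    exact ((continuous_evalEval F).tendsto (0, ξ₀)).comp (ht.prodMk_nhds hξ)
  rw [tendsto_pi_nhds]
  intro i
  fin_cases i
  · refine (hlim g).congr' ?_
    filter_upwards [ht0] with s hs
    exact (eval_eq_evalEval_of_comp_eq hP hg hs (ξ s)).symm
  · refine (hlim h).congr' ?_
    filter_upwards [ht0] with s hs
    exact (eval_eq_evalEval_of_comp_eq hQ hh hs (ξ s)).symm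

theorem curve_subset_nonProperValueSet (hm : m ≠ 0) (hP : DegreeLE P n) (hQ : DegreeLE Q n')
    (hg : ((dehomogenize n P).map (expand ℂ m).toRingHom).comp (C (X ^ k) * X + C w) =
      C (X ^ (m * n)) * g)
    (hh : ((dehomogenize n' Q).map (expand ℂ m).toRingHom).comp (C (X ^ k) * X + C w) =
      C (X ^ (m * n')) * h) :
    curve (g.map (evalRingHom 0)) (h.map (evalRingHom 0)) ⊆
      nonProperValueSet (polyMap P Q) := by
  rintro _ ⟨ξ, rfl⟩
  have ht : Tendsto (fun t : ℂ => t) (𝓝[≠] 0) (𝓝 0) := tendsto_id.mono_left nhdsWithin_le_nhds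
  have ht0 : ∀ᶠ t : ℂ in 𝓝[≠] 0, t ≠ 0 := self_mem_nhdsWithin
  refine mem_nonProperValueSet_of_tendsto ?_
    (tendsto_polyMap_of_comp_eq hP hQ hg hh ht ht0 (tendsto_const_nhds (x := ξ)))
  have h1 : Tendsto (fun t : ℂ => ‖(t ^ m)⁻¹‖) (𝓝[≠] 0) atTop := by
    refine (tendsto_norm_inv_nhdsNE_zero_atTop (α := ℂ)).comp ?_
    refine tendsto_nhdsWithin_iff.2 ⟨?_, ?_⟩
    · have := ht.pow m
      rwa [zero_pow hm] at this
    · filter_upwards [ht0] with t h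
      exact pow_ne_zero _ h
  refine tendsto_atTop_mono (fun t => ?_) h1
  exact norm_le_pi_norm (![(t ^ m)⁻¹, (t ^ m)⁻¹ * (t ^ k * ξ + w.eval t)] : Plane) 0

end Dicritical

end PlanePoly

/-! ### The finite cover of the non-proper value set. -/

namespace PlanePoly

open Polynomial NewtonChain Filter

/-- The non-proper value set is a finite union of polynomially parametrized curves of
proportional bidegrees. -/
theorem exists_finite_cover {P Q : Poly} {K d e : ℕ} {A B c : ℂ}
    (hP : DegreeLE P (d * K)) (hQ : DegreeLE Q (e * K)) (hJ : jacobian P Q = MvPolynomial.C c)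
    (hde : Nat.Coprime d e) (hd : 0 < d) (he : 0 < e) (hK : 0 < K)
    (hA : IsMonicInY P (d * K) A) (hB : IsMonicInY Q (e * K) B) :
    ∃ T : Set (ℂ[X] × ℂ[X]), T.Finite ∧
      (∀ r ∈ T, (∃ M, 1 ≤ M ∧ r.1.natDegree = d * M ∧ r.2.natDegree = e * M ∧
          B ^ d * r.1.leadingCoeff ^ e = A ^ e * r.2.leadingCoeff ^ d) ∧
        curve r.1 r.2 ⊆ nonProperValueSet (polyMap P Q)) ∧
      ∀ a ∈ nonProperValueSet (polyMap P Q), ∃ r ∈ T, a ∈ curve r.1 r.2 := by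
  obtain ⟨m, S, hm, hSm, hnS, hS, hroots⟩ := exists_common_approxRoots hP hQ hA hB
  have hN : d * (m * K) < d * (m * K) + e * (m * K) + 1 := by omega
  have hN' : e * (m * K) < d * (m * K) + e * (m * K) + 1 := by omega
  obtain ⟨u, u', hu, hu'⟩ := hroots (d * (m * K) + e * (m * K) + 1)
  -- The candidate centers are the roots of both polynomials; `good` keeps those at which both
  -- orders reach their targets.
  let W : Fin (d * K) ⊕ Fin (e * K) → ℂ[X] := Sum.elim u u'
  let good : Fin (d * K) ⊕ Fin (e * K) → Prop := fun j =>
    (∃ k, d * (m * K) ≤ totalOrder (fun i => expand ℂ S (W j) - expand ℂ S (u i)) k) ∧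
    ∃ k, e * (m * K) ≤ totalOrder (fun i => expand ℂ S (W j) - expand ℂ S (u' i)) k
  choose k M p q hM hp hk hpd hqd hlc hg hh using fun j : {j // good j} =>
    exists_dicritical_at_center hP hQ hJ hde hd he hK hm hA.1 hB.1 hS hSm hnS hu hu' hN hN'
      (W j) j.2.1 j.2.2
  choose g hg hg0 using hg
  choose h hh hh0 using hh
  have eP : d * (m * K) = m * (d * K) := by ring
  have eQ : e * (m * K) = m * (e * K) := by ring
  rw [eP] at hg
  rw [eQ] at hh
  refine ⟨Set.range fun j => (p j, q j), Set.finite_range _, ?_, fun a ha => ?_⟩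
  · rintro _ ⟨j, rfl⟩
    refine ⟨⟨M j, hM j, hpd j, hqd j, hlc j⟩, ?_⟩
    simp only
    rw [← hg0 j, ← hh0 j]
    exact curve_subset_nonProperValueSet hm hP hQ (hg j) (hh j)
  · obtain ⟨l, t, Y, R, hla, ht, ht0, hz, hY⟩ :=
      exists_branch (m := m) (by positivity) hm hP hA ha
    have hbound : ∀ i : Fin 2, ∀ᶠ z in (l : Filter Plane), ‖polyMap P Q z i‖ ≤ ‖a i‖ + 1 := by
      intro i
      have h1 : Tendsto (fun z => ‖polyMap P Q z i‖) (l : Filter Plane) (𝓝 ‖a i‖) :=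
        ((continuous_apply i).tendsto a |>.comp hla).norm
      exact (h1.eventually (gt_mem_nhds (lt_add_one _))).mono fun z hz => hz.le
    have hGb : ∀ᶠ z in (l : Filter Plane),
        ‖((dehomogenize (d * K) P).map (expand ℂ m).toRingHom).evalEval (t z) (Y z)‖ ≤
          (‖a 0‖ + 1) * ‖t z‖ ^ (d * (m * K)) := by
      filter_upwards [hbound 0, ht0, hz] with z h1 h2 h3
      rw [evalEval_map_expand_dehomogenize hP m h2, ← h3, norm_mul, norm_pow, mul_comm, eP]
      exact mul_le_mul_of_nonneg_right h1 (by positivity)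
    have hHb : ∀ᶠ z in (l : Filter Plane),
        ‖((dehomogenize (e * K) Q).map (expand ℂ m).toRingHom).evalEval (t z) (Y z)‖ ≤
          (‖a 1‖ + 1) * ‖t z‖ ^ (e * (m * K)) := by
      filter_upwards [hbound 1, ht0, hz] with z h1 h2 h3
      rw [evalEval_map_expand_dehomogenize hQ m h2, ← h3, norm_mul, norm_pow, mul_comm, eQ]
      exact mul_le_mul_of_nonneg_right h1 (by positivity)
    have : Nonempty (Fin (d * K) ⊕ Fin (e * K)) := ⟨Sum.inl ⟨0, by positivity⟩⟩
    -- Among finitely many roots, the ultrafilter selects a single one that is nearest throughout.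
    obtain ⟨j, hj⟩ := Ultrafilter.eventually_exists_iff.1
      (Eventually.of_forall (f := (l : Filter Plane)) fun z =>
        Finite.exists_min fun j => ‖Y z - (expand ℂ S (W j)).eval (t z)‖)
    have hnear : ∀ᶠ z in (l : Filter Plane), ∀ i, ‖Y z - (expand ℂ S (W j)).eval (t z)‖ ≤
        ‖Y z - (expand ℂ S (u i)).eval (t z)‖ := hj.mono fun z hz i => hz (Sum.inl i)
    have hnear' : ∀ᶠ z in (l : Filter Plane), ∀ i, ‖Y z - (expand ℂ S (W j)).eval (t z)‖ ≤
        ‖Y z - (expand ℂ S (u' i)).eval (t z)‖ := hj.mono fun z hz i => hz (Sum.inr i)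
    have hgood : good j := ⟨⟨_, hu.le_totalOrder hA.1 hN.le ht ht0 hY hGb hnear⟩,
      ⟨_, hu'.le_totalOrder hB.1 hN'.le ht ht0 hY hHb hnear'⟩⟩
    let j' : {j // good j} := ⟨j, hgood⟩
    have hdeg : (residuePoly A (fun i => expand ℂ S (W j) - expand ℂ S (u i)) (k j')).natDegree
        ≠ 0 := by
      have h1 := hpd j'
      rw [hp j'] at h1
      rw [h1]
      have := hM j'
      positivity
    obtain ⟨R', hR'⟩ := hu.exists_eventually_norm_le hA.1 hN.le ht ht0 hY hGb hnear (hk j') hdeg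
    -- The bounded parameter `ξ` converges along the ultrafilter, and its limit parametrizes `a`.
    obtain ⟨ξ₀, _, hξ₀⟩ := isCompact_iff_ultrafilter_le_nhds'.1 (isCompact_closedBall (0 : ℂ) R')
      (l.map fun z => (Y z - (expand ℂ S (W j)).eval (t z)) / t z ^ k j')
      (by
        rw [Ultrafilter.mem_map]
        filter_upwards [hR'] with z hz
        simpa using hz)
    have hlim := tendsto_polyMap_of_comp_eq hP hQ (hg j') (hh j') ht ht0 hξ₀
    rw [hg0, hh0] at hlim
    refine ⟨_, ⟨j', rfl⟩, ξ₀, ?_⟩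
    refine tendsto_nhds_unique (hlim.congr' ?_) hla
    filter_upwards [ht0, hz] with z h1 h2
    have e1 : t z ^ k j' * ((Y z - (expand ℂ S (W j)).eval (t z)) / t z ^ k j') +
        (expand ℂ S (W j)).eval (t z) = Y z := by
      rw [mul_div_cancel₀ _ (pow_ne_zero _ h1), sub_add_cancel]
    change polyMap P Q ![(t z ^ m)⁻¹, (t z ^ m)⁻¹ * (t z ^ k j' *
      ((Y z - (expand ℂ S (W j)).eval (t z)) / t z ^ k j') +
        (expand ℂ S (W j)).eval (t z))] = polyMap P Q z
    rw [e1, ← h2]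

/-! ### Zariski topology of parametrized curves and normalization of the parameter. -/

theorem isTopologicalBasis_zariski :
    @TopologicalSpace.IsTopologicalBasis Plane zariski
      {U | ∃ g : Poly, U = {z | MvPolynomial.eval z g ≠ 0}} := by
  refine @TopologicalSpace.isTopologicalBasis_of_subbasis_of_finiteInter Plane zariski _ rfl ⟨?_, ?_⟩
  · exact ⟨1, by simp⟩
  · rintro _ ⟨g, rfl⟩ _ ⟨h, rfl⟩
    refine ⟨g * h, ?_⟩
    ext z
    simp

/-- A polynomially parametrized curve is irreducible in the Zariski topology. -/
theorem isIrreducible_curve (p q : ℂ[X]) : @IsIrreducible Plane zariski (curve p q) := by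
  refine ⟨Set.range_nonempty _, ?_⟩
  have heval : ∀ (g : Poly) (ξ : ℂ), MvPolynomial.eval ![p.eval ξ, q.eval ξ] g =
      (MvPolynomial.aeval ![p, q] g).eval ξ := by
    intro g ξ
    induction g using MvPolynomial.induction_on with
    | C a => simp
    | add g h hg hh => simp [hg, hh]
    | mul_X g i hg =>
      rw [map_mul, map_mul, eval_mul, hg]
      fin_cases i <;> simp
  rintro U V hU hV ⟨_, ⟨ξ, rfl⟩, hξU⟩ ⟨_, ⟨η, rfl⟩, hηV⟩
  obtain ⟨_, ⟨g, rfl⟩, hg, hgU⟩ :=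
    @TopologicalSpace.IsTopologicalBasis.exists_subset_of_mem_open Plane zariski _
      isTopologicalBasis_zariski _ _ hξU hU
  obtain ⟨_, ⟨h, rfl⟩, hh, hhV⟩ :=
    @TopologicalSpace.IsTopologicalBasis.exists_subset_of_mem_open Plane zariski _
      isTopologicalBasis_zariski _ _ hηV hV
  simp only [Set.mem_ofPred_eq, heval] at hg hh
  have hne : MvPolynomial.aeval ![p, q] g * MvPolynomial.aeval ![p, q] h ≠ 0 := by
    refine mul_ne_zero ?_ ?_
    · intro h0; simp [h0] at hg
    · intro h0; simp [h0] at hh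
  obtain ⟨ζ, hζ⟩ : ∃ ζ,
      (MvPolynomial.aeval ![p, q] g * MvPolynomial.aeval ![p, q] h).eval ζ ≠ 0 := by
    by_contra hcon
    push Not at hcon
    exact hne (funext fun ζ => by rw [hcon ζ, eval_zero])
  rw [eval_mul, ← heval, ← heval] at hζ
  exact ⟨_, ⟨ζ, rfl⟩, hgU (left_ne_zero_of_mul hζ), hhV (right_ne_zero_of_mul hζ)⟩

/-- A polynomially parametrized curve is closed in the Zariski topology. -/
theorem isClosed_curve {p : ℂ[X]} (hp : p.natDegree ≠ 0) (q : ℂ[X]) :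
    @IsClosed Plane zariski (curve p q) := by
  let f : Polynomial Poly := p.map MvPolynomial.C - C (MvPolynomial.X 0)
  let g : Polynomial Poly := q.map MvPolynomial.C - C (MvPolynomial.X 1)
  -- The equation of the curve is the resultant in `ξ` of `p(ξ) - x` and `q(ξ) - y`. Specializing
  -- `x`, `y` keeps the degrees, because `p - C (z 0)` and `q - C (z 1)` have those of `p` and `q`;
  -- so it vanishes exactly when there is a common root.
  have hmem : ∀ z : Plane, z ∈ curve p q ↔
      MvPolynomial.eval z (resultant f g p.natDegree q.natDegree) = 0 := by
    intro z
    rw [← resultant_map_map]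
    have hmap : ∀ r : ℂ[X], (r.map MvPolynomial.C).map (MvPolynomial.eval z) = r := by
      intro r
      ext i
      simp
    have hf : f.map (MvPolynomial.eval z) = p - C (z 0) := by
      simp only [f, Polynomial.map_sub, hmap, map_C, MvPolynomial.eval_X]
    have hg : g.map (MvPolynomial.eval z) = q - C (z 1) := by
      simp only [g, Polynomial.map_sub, hmap, map_C, MvPolynomial.eval_X]
    have hpd : (p - C (z 0)).natDegree = p.natDegree := natDegree_sub_C
    have hqd : (q - C (z 1)).natDegree = q.natDegree := natDegree_sub_C
    have hp0 : p - C (z 0) ≠ 0 := by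
      intro h0
      rw [h0, natDegree_zero] at hpd
      exact hp hpd.symm
    rw [hf, hg, ← hpd, ← hqd, resultant_eq_zero_iff]
    constructor
    · rintro ⟨ξ, rfl⟩
      refine ⟨Or.inl hp0, fun ⟨a, b, hab⟩ => ?_⟩
      have := congrArg (eval ξ) hab
      simp at this
    · rintro ⟨_, hcop⟩
      rw [isCoprime_iff_aeval_ne_zero_of_isAlgClosed ℂ ℂ] at hcop
      push Not at hcop
      obtain ⟨ξ, h1, h2⟩ := hcop
      refine ⟨ξ, ?_⟩
      ext i
      fin_cases i
      · simpa [sub_eq_zero] using h1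
      · simpa [sub_eq_zero] using h2
  have hcompl : (curve p q)ᶜ =
      {z | MvPolynomial.eval z (resultant f g p.natDegree q.natDegree) ≠ 0} := by
    ext z
    rw [Set.mem_compl_iff, hmem, Set.mem_ofPred_eq]
  refine @IsClosed.mk Plane zariski _ ?_
  rw [hcompl]
  exact TopologicalSpace.isOpen_generateFrom_of_mem ⟨_, rfl⟩

/-- Bézout: with `d * a + e * b = 1` take `r = s ^ a * t ^ b`. -/
theorem exists_pow_eq_of_coprime {d e : ℕ} (hde : Nat.Coprime d e) {s t : ℂ} (hs : s ≠ 0)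
    (ht : t ≠ 0) (h : s ^ e = t ^ d) : ∃ r : ℂ, r ≠ 0 ∧ r ^ d = s ∧ r ^ e = t := by
  have hb : (d : ℤ) * d.gcdA e + e * d.gcdB e = 1 := by
    rw [← Nat.gcd_eq_gcd_ab, hde]; simp
  have h' : s ^ (e : ℤ) = t ^ (d : ℤ) := by exact_mod_cast h
  refine ⟨s ^ d.gcdA e * t ^ d.gcdB e, mul_ne_zero (zpow_ne_zero _ hs) (zpow_ne_zero _ ht), ?_, ?_⟩
  · rw [← zpow_natCast, mul_zpow, ← zpow_mul, ← zpow_mul, mul_comm (d.gcdB e), zpow_mul t, ← h',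
      ← zpow_mul, ← zpow_add₀ hs, mul_comm (d.gcdA e), hb, zpow_one]
  · rw [← zpow_natCast, mul_zpow, ← zpow_mul, ← zpow_mul, mul_comm (d.gcdA e), zpow_mul s, h',
      ← zpow_mul, ← zpow_add₀ ht, mul_comm (d.gcdB e), hb, zpow_one]

/-- A parametrization may be rescaled to have prescribed leading coefficients. -/
theorem exists_rescale {p q : ℂ[X]} {d e M : ℕ} {A B : ℂ} (hde : Nat.Coprime d e) (hA : A ≠ 0)
    (hB : B ≠ 0) (hM : 1 ≤ M) (hp0 : p ≠ 0) (hq0 : q ≠ 0)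
    (hp : p.natDegree = d * M) (hq : q.natDegree = e * M)
    (hlc : B ^ d * p.leadingCoeff ^ e = A ^ e * q.leadingCoeff ^ d) :
    ∃ p' q' : ℂ[X], p'.natDegree = M * d ∧ p'.leadingCoeff = A ∧ q'.natDegree = M * e ∧
      q'.leadingCoeff = B ∧ curve p q = curve p' q' := by
  have hp1 := leadingCoeff_ne_zero.2 hp0
  have hq1 := leadingCoeff_ne_zero.2 hq0
  obtain ⟨r, hr, hrd, hre⟩ := exists_pow_eq_of_coprime hde (div_ne_zero hA hp1)
    (div_ne_zero hB hq1) (by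
      rw [div_pow, div_pow, div_eq_div_iff (pow_ne_zero _ hp1) (pow_ne_zero _ hq1)]
      exact hlc.symm)
  -- Replacing `ξ` by `c * ξ` multiplies the leading coefficients by `(c ^ M) ^ d` and `(c ^ M) ^
  -- e`.
  obtain ⟨c, hc⟩ := IsAlgClosed.exists_pow_nat_eq r hM
  have hc0 : c ≠ 0 := by
    rintro rfl
    rw [zero_pow (by omega)] at hc
    exact hr hc.symm
  have hdeg : (C c * X : ℂ[X]).natDegree = 1 := natDegree_C_mul_X c hc0
  have hlead : (C c * X : ℂ[X]).leadingCoeff = c := by simp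
  refine ⟨p.comp (C c * X), q.comp (C c * X), ?_, ?_, ?_, ?_, ?_⟩
  · rw [natDegree_comp, hdeg, hp]; ring
  · rw [leadingCoeff_comp (by rw [hdeg]; exact one_ne_zero), hlead, hp, mul_comm d M, pow_mul, hc,
      hrd, mul_div_cancel₀ _ hp1]
  · rw [natDegree_comp, hdeg, hq]; ring
  · rw [leadingCoeff_comp (by rw [hdeg]; exact one_ne_zero), hlead, hq, mul_comm e M, pow_mul, hc,
      hre, mul_div_cancel₀ _ hq1]
  · ext z
    constructor
    · rintro ⟨ξ, rfl⟩
      exact ⟨c⁻¹ * ξ, by simp [hc0]⟩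
    · rintro ⟨ξ, rfl⟩
      exact ⟨c * ξ, by simp⟩

end PlanePoly

theorem theorem1 (P Q : PlanePoly.Poly) (K d e : ℕ) (A B : ℂ)
    (hJ : ∃ c : ℂ, c ≠ 0 ∧ PlanePoly.jacobian P Q = MvPolynomial.C c)
    (hP : P.totalDegree = K * d) (hQ : Q.totalDegree = K * e)
    (hde : Nat.gcd d e = 1)
    (hPy : PlanePoly.IsMonicInY P (K * d) A)
    (hQy : PlanePoly.IsMonicInY Q (K * e) B)
    (hne : (PlanePoly.nonProperValueSet (PlanePoly.polyMap P Q)).Nonempty) :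
    ∀ Z : Set PlanePoly.Plane,
      PlanePoly.IsIrreducibleComponent Z
        (PlanePoly.nonProperValueSet (PlanePoly.polyMap P Q)) →
      ∃ m : ℕ, 1 ≤ m ∧ ∃ p q : Polynomial ℂ,
        p.natDegree = m * d ∧ p.leadingCoeff = A ∧
        q.natDegree = m * e ∧ q.leadingCoeff = B ∧
        Z = Set.range (fun ξ : ℂ => (![p.eval ξ, q.eval ξ] : PlanePoly.Plane)) := by
  intro Z hZ
  obtain ⟨c, hc, hJ⟩ := hJ
  have hpd : ∀ R : PlanePoly.Poly, R.totalDegree = 0 → ∀ i, MvPolynomial.pderiv i R = 0 := by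
    intro R hR i
    rw [MvPolynomial.totalDegree_eq_zero_iff_eq_C.1 hR, MvPolynomial.pderiv_C]
  -- A constant `P` or `Q` would make the Jacobian zero; hence `K`, `d`, `e` are positive.
  have hKd : K * d ≠ 0 := by
    intro h0
    rw [PlanePoly.jacobian, hpd P (hP.trans h0), hpd P (hP.trans h0), zero_mul, zero_mul, sub_zero,
      eq_comm, MvPolynomial.C_eq_zero] at hJ
    exact hc hJ
  have hKe : K * e ≠ 0 := by
    intro h0
    rw [PlanePoly.jacobian, hpd Q (hQ.trans h0), hpd Q (hQ.trans h0), mul_zero, mul_zero, sub_zero,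
      eq_comm, MvPolynomial.C_eq_zero] at hJ
    exact hc hJ
  have hK : 0 < K := Nat.pos_of_ne_zero (left_ne_zero_of_mul hKd)
  have hd : 0 < d := Nat.pos_of_ne_zero (right_ne_zero_of_mul hKd)
  have he : 0 < e := Nat.pos_of_ne_zero (right_ne_zero_of_mul hKe)
  rw [mul_comm K d] at hP hPy
  rw [mul_comm K e] at hQ hQy
  obtain ⟨T, hT, hTc, hcover⟩ := PlanePoly.exists_finite_cover
    (PlanePoly.degreeLE_of_totalDegree_le hP.le) (PlanePoly.degreeLE_of_totalDegree_le hQ.le) hJ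
    hde hd he hK hPy hQy
  have hclosed : ∀ r ∈ T, @IsClosed PlanePoly.Plane PlanePoly.zariski
      (PlanePoly.curve r.1 r.2) := by
    intro r hr
    obtain ⟨⟨M, hM, h1, _⟩, _⟩ := hTc r hr
    exact PlanePoly.isClosed_curve (by rw [h1]; positivity) _
  obtain ⟨⟨hZs, hZi⟩, hmax⟩ := hZ
  -- An irreducible set covered by finitely many closed curves lies in one of them; maximality then
  -- gives equality, as that curve is itself irreducible and contained in the non-proper value set.
  obtain ⟨_, hr', hZr⟩ := (@isIrreducible_iff_sUnion_isClosed PlanePoly.Plane PlanePoly.zariski Z).1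
    hZi (hT.image fun r => PlanePoly.curve r.1 r.2).toFinset
    (by
      intro s hs
      rw [Set.Finite.mem_toFinset] at hs
      obtain ⟨r, hr, rfl⟩ := hs
      exact hclosed r hr)
    (by
      intro a ha
      obtain ⟨r, hr, har⟩ := hcover a (hZs ha)
      rw [Set.Finite.coe_toFinset]
      exact ⟨_, ⟨r, hr, rfl⟩, har⟩)
  rw [Set.Finite.mem_toFinset] at hr'
  obtain ⟨r, hr, rfl⟩ := hr'
  obtain ⟨⟨M, hM, h1, h2, h3⟩, hsub⟩ := hTc r hr
  have hZeq : Z = PlanePoly.curve r.1 r.2 :=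
    Set.Subset.antisymm hZr (hmax ⟨hsub, PlanePoly.isIrreducible_curve _ _⟩ hZr)
  have hp0 : r.1 ≠ 0 := by
    intro h0
    rw [h0, Polynomial.natDegree_zero] at h1
    have : 0 < d * M := by positivity
    omega
  have hq0 : r.2 ≠ 0 := by
    intro h0
    rw [h0, Polynomial.natDegree_zero] at h2
    have : 0 < e * M := by positivity
    omega
  obtain ⟨p, q, hp1, hp2, hq1, hq2, hpq⟩ :=
    PlanePoly.exists_rescale hde hPy.1 hQy.1 hM hp0 hq0 h1 h2 h3
  exact ⟨M, hM, p, q, hp1, hp2, hq1, hq2, hZeq.trans hpq⟩
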